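/- **Proposition.** Let $K$ be a field of characteristic zero, let $D\ge 0$ be an integer, and let $J(D)$ be the free (non-unital) Jordan $K$-algebra on $D$ generators, i.e. the free commutative, non-associative, non-unital algebra modulo the Jordan identity $x^2(yx)=(x^2y)x$. For a Jordan algebra $J$ and $a,b\in J$, let $\partial_{a,b}$ be the derivation $z\mapsto a(zb)-(az)b$ of $J$. Let ${\cal B}J=\Lambda^2J/R(J)$, where $R(J)$ is the linear span of all $a\wedge a^2$, $a\in J$, and write $\{\omega\}$ for the class of $\omega\in\Lambda^2J$; for $\omega=\sum_i a_i\wedge b_i$ put $\partial_\omega=\sum_i\partial_{a_i,b_i}$, which acts on ${\cal B}J$ by $\partial_\omega.\{a\wedge b\}=\{\partial_\omega a\wedge b+a\wedge\partial_\omega b\}$. The Tits–Allison–Gao Lie algebra of $J$ is the vector space $$\mathfrak{sl}_2\,J={\cal B}J\oplus(\mathfrak{sl}_2\otimes J)$$ with the bracket $$[x(a),y(b)]=[x,y](ab)+\kappa(x,y)\{a\wedge b\},\qquad [\{\omega\},x(a)]=x(\partial_\omega a),\qquad [\{\omega\},\{\omega'\}]=\partial_\omega.\{\omega'\},$$ where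 $x(a)=x\otimes a$ and $\kappa(x,y)=\tfrac12\mathrm{Tr}(\mathrm{ad}\,x\circ\mathrm{ad}\,y)$ for $x,y\in\mathfrak{sl}_2=\mathfrak{sl}_2(K)$. The Lie algebra $\mathfrak{sl}_2$ acts on $\mathfrak{sl}_2\,J$ by derivations, trivially on ${\cal B}J$ and by $x\cdot y(a)=[x,y](a)$ on $\mathfrak{sl}_2\otimes J$, and hence on the Chevalley–Eilenberg homology $H_*(\mathfrak{sl}_2\,J)$ with trivial coefficients $K$. Then the $\mathfrak{sl}_2$-invariant part of the third homology of $\mathfrak{sl}_2\,J(D)$ vanishes: $$H_3(\mathfrak{sl}_2\,J(D))^{\mathfrak{sl}_2}=0 .$$ -/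

import Mathlib

open scoped TensorProduct

set_option linter.unusedSectionVars false

noncomputable section

/-! ### Free Jordan algebras -/

/-- The relations of the free Jordan algebra: `FreeJordan K X` is the quotient of the free
non-associative, non-unital `K`-algebra on `X` by the smallest congruence that contains
commutativity and the Jordan identity `x²(yx) = (x²y)x`. -/
inductive FreeJordan.Rel (K X : Type*) [CommRing K] :
    FreeNonUnitalNonAssocAlgebra K X → FreeNonUnitalNonAssocAlgebra K X → Prop
  | comm (a b) : Rel K X (a * b) (b * a)
  | jordan (a b) : Rel K X ((a * a) * (b * a)) (((a * a) * b) * a)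
  | smul (t : K) {a b} : Rel K X a b → Rel K X (t • a) (t • b)
  | add_right {a b} (c) : Rel K X a b → Rel K X (a + c) (b + c)
  | mul_left (a) {b c} : Rel K X b c → Rel K X (a * b) (a * c)
  | mul_right {a b} (c) : Rel K X a b → Rel K X (a * c) (b * c)

/-- The free (non-unital) Jordan `K`-algebra on the set `X` of generators. -/
def FreeJordan (K X : Type*) [CommRing K] : Type _ := Quot (FreeJordan.Rel K X)

namespace FreeJordan

variable {K X : Type*} [CommRing K]

theorem Rel.addLeft (a : FreeNonUnitalNonAssocAlgebra K X) {b c} (h : Rel K X b c) :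
    Rel K X (a + b) (a + c) := by
  rw [add_comm _ b, add_comm _ c]; exact h.add_right _

theorem Rel.neg {a b : FreeNonUnitalNonAssocAlgebra K X} (h : Rel K X a b) :
    Rel K X (-a) (-b) := by
  simpa only [neg_one_smul] using h.smul (-1)

instance : SMul K (FreeJordan K X) where smul t := Quot.map (t • ·) fun _ _ h => h.smul t
instance : Zero (FreeJordan K X) where zero := Quot.mk _ 0
instance : Add (FreeJordan K X) where
  add := Quot.map₂ (· + ·) (fun _ _ _ => Rel.addLeft _) fun _ _ _ => Rel.add_right _
instance : Neg (FreeJordan K X) where neg := Quot.map Neg.neg fun _ _ => Rel.neg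
instance : Mul (FreeJordan K X) where
  mul := Quot.map₂ (· * ·) (fun _ _ _ => Rel.mul_left _) fun _ _ _ => Rel.mul_right _

instance : NonUnitalNonAssocCommRing (FreeJordan K X) where
  nsmul := nsmulRec
  zsmul := zsmulRec
  add_assoc := by rintro ⟨a⟩ ⟨b⟩ ⟨c⟩; exact congrArg (Quot.mk _) (add_assoc a b c)
  zero_add := by rintro ⟨a⟩; exact congrArg (Quot.mk _) (zero_add a)
  add_zero := by rintro ⟨a⟩; exact congrArg (Quot.mk _) (add_zero a)
  add_comm := by rintro ⟨a⟩ ⟨b⟩; exact congrArg (Quot.mk _) (add_comm a b)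
  neg_add_cancel := by rintro ⟨a⟩; exact congrArg (Quot.mk _) (neg_add_cancel a)
  left_distrib := by rintro ⟨a⟩ ⟨b⟩ ⟨c⟩; exact congrArg (Quot.mk _) (mul_add a b c)
  right_distrib := by rintro ⟨a⟩ ⟨b⟩ ⟨c⟩; exact congrArg (Quot.mk _) (add_mul a b c)
  zero_mul := by rintro ⟨a⟩; exact congrArg (Quot.mk _) (zero_mul a)
  mul_zero := by rintro ⟨a⟩; exact congrArg (Quot.mk _) (mul_zero a)
  mul_comm := by rintro ⟨a⟩ ⟨b⟩; exact Quot.sound (Rel.comm a b)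

instance : Module K (FreeJordan K X) where
  one_smul := by rintro ⟨a⟩; exact congrArg (Quot.mk _) (one_smul K a)
  mul_smul := by rintro s t ⟨a⟩; exact congrArg (Quot.mk _) (mul_smul s t a)
  smul_zero := by intro t; exact congrArg (Quot.mk _) (smul_zero t)
  smul_add := by rintro t ⟨a⟩ ⟨b⟩; exact congrArg (Quot.mk _) (smul_add t a b)
  add_smul := by rintro s t ⟨a⟩; exact congrArg (Quot.mk _) (add_smul s t a)
  zero_smul := by rintro ⟨a⟩; exact congrArg (Quot.mk _) (zero_smul K a)

instance : IsScalarTower K (FreeJordan K X) (FreeJordan K X) where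
  smul_assoc := by rintro t ⟨a⟩ ⟨b⟩; exact congrArg (Quot.mk _) (smul_mul_assoc t a b)

instance : SMulCommClass K (FreeJordan K X) (FreeJordan K X) where
  smul_comm := by rintro t ⟨a⟩ ⟨b⟩; exact congrArg (Quot.mk _) (mul_smul_comm t a b).symm

instance : IsCommJordan (FreeJordan K X) where
  lmul_comm_rmul_rmul := by
    have key : ∀ a b : FreeJordan K X, (a * a) * (b * a) = ((a * a) * b) * a := by
      rintro ⟨a⟩ ⟨b⟩
      exact Quot.sound (Rel.jordan a b)
    intro a b
    rw [mul_comm (a * b), mul_comm a b, key, mul_comm _ a, mul_comm b]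

/-- The generators of the free Jordan algebra. -/
def of (x : X) : FreeJordan K X := Quot.mk _ (FreeNonUnitalNonAssocAlgebra.of K x)

end FreeJordan

/-! ### Chevalley–Eilenberg homology of a Lie algebra -/

namespace LieHomology

open ExteriorAlgebra

variable {K L : Type*} [CommRing K]

section Module
variable [AddCommGroup L] [Module K L]

/-- The derivation of the exterior algebra `Λ L` that extends an endomorphism `φ` of `L`, i.e.
`x₁ ∧ ⋯ ∧ xₖ ↦ ∑ᵢ x₁ ∧ ⋯ ∧ φ xᵢ ∧ ⋯ ∧ xₖ`; it is determined by `extDer_one` and `extDer_ι_mul`. -/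
def extDer (φ : L →ₗ[K] L) : ExteriorAlgebra K L →ₗ[K] ExteriorAlgebra K L :=
  CliffordAlgebra.foldr' (0 : QuadraticForm K L)
    (LinearMap.mk₂ K (fun (y : L) (p : ExteriorAlgebra K L × ExteriorAlgebra K L) =>
        ι K (φ y) * p.1 + ι K y * p.2)
      (fun _ _ _ => by simp only [map_add, add_mul]; abel)
      (fun _ _ _ => by simp only [map_smul, smul_mul_assoc, smul_add])
      (fun _ _ _ => by simp only [Prod.fst_add, Prod.snd_add, mul_add]; abel)
      (fun _ _ _ => by simp only [Prod.smul_fst, Prod.smul_snd, mul_smul_comm, smul_add]))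
    (fun y w v => by
      have h1 := ι_add_mul_swap (R := K) (φ y) y
      have h2 := ι_sq_zero (R := K) y
      simp only [LinearMap.mk₂_apply, mul_add, ← mul_assoc]
      rw [← add_assoc, ← add_mul]
      erw [h1, h2]
      simp) 0

@[simp] theorem extDer_one (φ : L →ₗ[K] L) : extDer φ 1 = 0 := by
  have h : extDer φ (algebraMap K _ 1) = (1 : K) • (0 : ExteriorAlgebra K L) :=
    CliffordAlgebra.foldr'_algebraMap _ _ _ _ _
  rwa [map_one, smul_zero] at h

@[simp] theorem extDer_ι_mul (φ : L →ₗ[K] L) (y : L) (w : ExteriorAlgebra K L) :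
    extDer φ (ι K y * w) = ι K (φ y) * w + ι K y * extDer φ w :=
  CliffordAlgebra.foldr'_ι_mul (0 : QuadraticForm K L) _ _ 0 y w

@[simp] theorem extDer_ι (φ : L →ₗ[K] L) (y : L) : extDer φ (ι K y) = ι K (φ y) := by
  rw [← mul_one (ι K y), extDer_ι_mul, extDer_one, mul_zero, add_zero, mul_one]

/-- Two linear maps on `Λ L` agree if they do so on `1` and on `y ∧ w` whenever they do on `w`. -/
theorem ext_ind {f g : ExteriorAlgebra K L →ₗ[K] ExteriorAlgebra K L} (h1 : f 1 = g 1)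
    (h2 : ∀ y w, f w = g w → f (ι K y * w) = g (ι K y * w)) : f = g := by
  refine LinearMap.ext fun w => ?_
  induction w using CliffordAlgebra.left_induction with
  | algebraMap r => rw [Algebra.algebraMap_eq_smul_one, map_smul, map_smul, h1]
  | add x y hx hy => rw [map_add, map_add, hx, hy]
  | ι_mul x m hx => exact h2 m x hx

theorem extDer_add (φ ψ : L →ₗ[K] L) : extDer (φ + ψ) = extDer φ + extDer ψ := by
  refine ext_ind (by simp) fun y w h => ?_
  simp only [extDer_ι_mul, h, LinearMap.add_apply, map_add, mul_add, add_mul]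
  abel

theorem extDer_smul (t : K) (φ : L →ₗ[K] L) : extDer (t • φ) = t • extDer φ := by
  refine ext_ind (by simp) fun y w h => ?_
  simp only [extDer_ι_mul, h, LinearMap.smul_apply, map_smul, smul_add, smul_mul_assoc,
    mul_smul_comm]

theorem extDer_comm (φ ψ : L →ₗ[K] L) :
    extDer (φ ∘ₗ ψ - ψ ∘ₗ φ) = extDer φ ∘ₗ extDer ψ - extDer ψ ∘ₗ extDer φ := by
  refine ext_ind (by simp) fun y w h => ?_
  simp only [extDer_ι_mul, h, LinearMap.sub_apply, LinearMap.comp_apply, map_add, map_sub,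
    sub_mul, mul_sub]
  abel

theorem extDer_mem (φ : L →ₗ[K] L) (k : ℕ) {w : ExteriorAlgebra K L} (hw : w ∈ ⋀[K]^k L) :
    extDer φ w ∈ ⋀[K]^k L := by
  induction k generalizing w with
  | zero =>
    rw [exteriorPower, pow_zero] at hw
    obtain ⟨r, rfl⟩ := Submodule.mem_one.1 hw
    rw [Algebra.algebraMap_eq_smul_one, map_smul, extDer_one, smul_zero]
    exact zero_mem _
  | succ k ih =>
    rw [exteriorPower, pow_succ'] at hw
    induction hw using Submodule.mul_induction_on' with
    | mem_mul_mem m hm n hn =>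
      obtain ⟨y, rfl⟩ := hm
      rw [extDer_ι_mul, exteriorPower, pow_succ']
      exact add_mem (Submodule.mul_mem_mul ⟨_, rfl⟩ hn) (Submodule.mul_mem_mul ⟨_, rfl⟩ (ih hn))
    | add x _ y _ hx hy => rw [map_add]; exact add_mem hx hy

end Module

variable [LieRing L] [LieAlgebra K L]

variable (K L) in
/-- The Chevalley–Eilenberg differential of the Lie algebra `L` (trivial coefficients), on the
whole exterior algebra `Λ L`. It is determined by `ceD 1 = 0` and
`ceD (x ∧ w) = x • w - x ∧ ceD w`, where `x • w` is the adjoint action of `x ∈ L` on `Λ L`. So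
`ceD (x₁ ∧ ⋯ ∧ xₖ) = ∑_{i<j} (-1)^(i+j+1) ⁅xᵢ, xⱼ⁆ ∧ x₁ ∧ ⋯ x̂ᵢ ⋯ x̂ⱼ ⋯ ∧ xₖ`. -/
def ceD : ExteriorAlgebra K L →ₗ[K] ExteriorAlgebra K L :=
  CliffordAlgebra.foldr' (0 : QuadraticForm K L)
    (LinearMap.mk₂ K (fun (x : L) (p : ExteriorAlgebra K L × ExteriorAlgebra K L) =>
        extDer (LieModule.toEnd K L L x : L →ₗ[K] L) p.1 - ι K x * p.2)
      (fun _ _ _ => by simp only [map_add, add_mul, extDer_add, LinearMap.add_apply]; abel)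
      (fun _ _ _ => by
        simp only [map_smul, smul_mul_assoc, smul_sub, extDer_smul, LinearMap.smul_apply])
      (fun _ _ _ => by simp only [Prod.fst_add, Prod.snd_add, mul_add, map_add]; abel)
      (fun _ _ _ => by simp only [Prod.smul_fst, Prod.smul_snd, mul_smul_comm, smul_sub, map_smul]))
    (fun y w v => by
      have h2 := ι_sq_zero (R := K) y
      simp only [LinearMap.mk₂_apply]
      erw [extDer_ι_mul]
      simp only [LieModule.toEnd_apply_apply, lie_self, map_zero, zero_mul, mul_sub, ← mul_assoc]
      erw [h2]
      simp) 0

@[simp] theorem ceD_one : ceD K L 1 = 0 := by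
  have h : ceD K L (algebraMap K _ 1) = (1 : K) • (0 : ExteriorAlgebra K L) :=
    CliffordAlgebra.foldr'_algebraMap _ _ _ _ _
  rwa [map_one, smul_zero] at h

@[simp] theorem ceD_ι_mul (x : L) (w : ExteriorAlgebra K L) :
    ceD K L (ι K x * w) = extDer (LieModule.toEnd K L L x : L →ₗ[K] L) w - ι K x * ceD K L w :=
  CliffordAlgebra.foldr'_ι_mul (0 : QuadraticForm K L) _ _ 0 x w

@[simp] theorem ceD_ι (x : L) : ceD K L (ι K x) = 0 := by
  rw [← mul_one (ι K x), ceD_ι_mul, extDer_one, ceD_one, mul_zero, sub_zero]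

theorem ceD_two (x y : L) : ceD K L (ι K x * ι K y) = ι K ⁅x, y⁆ := by
  simp

theorem ceD_three (x y z : L) : ceD K L (ι K x * (ι K y * ι K z)) =
    ι K ⁅x, y⁆ * ι K z - ι K ⁅x, z⁆ * ι K y + ι K ⁅y, z⁆ * ι K x := by
  have e : ∀ a b : L, ι K a * ι K b = - (ι K b * ι K a) := fun a b =>
    eq_neg_of_add_eq_zero_left (ι_add_mul_swap a b)
  simp only [ceD_ι_mul, extDer_ι_mul, extDer_ι, ceD_ι, mul_zero, sub_zero,
    LieModule.toEnd_apply_apply]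
  rw [e y ⁅x, z⁆, e x ⁅y, z⁆]
  abel

/-- A derivation of the Lie algebra `L` acts on `Λ L` by a map of complexes. -/
theorem ceD_comp_extDer (D : LieDerivation K L L) :
    ceD K L ∘ₗ extDer (D : L →ₗ[K] L) = extDer (D : L →ₗ[K] L) ∘ₗ ceD K L := by
  refine ext_ind (by simp) fun y w h => ?_
  have hc := LinearMap.congr_fun
    (extDer_comm (D : L →ₗ[K] L) (LieModule.toEnd K L L y : L →ₗ[K] L)) w
  have hD : (D : L →ₗ[K] L) ∘ₗ (LieModule.toEnd K L L y : L →ₗ[K] L)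
      - (LieModule.toEnd K L L y : L →ₗ[K] L) ∘ₗ (D : L →ₗ[K] L)
      = (LieModule.toEnd K L L (D y) : L →ₗ[K] L) := by
    ext z
    simp
  rw [hD] at hc
  simp only [LinearMap.comp_apply, LinearMap.sub_apply] at h hc
  simp only [LinearMap.comp_apply, extDer_ι_mul, ceD_ι_mul, map_add, map_sub, h,
    LieDerivation.coeFn_coe, hc]
  abel

theorem ceD_comp_ceD : ceD K L ∘ₗ ceD K L = 0 := by
  refine ext_ind (by simp) fun y w h => ?_
  have hc := LinearMap.congr_fun (ceD_comp_extDer (LieDerivation.ad K L y)) w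
  have hy : ((LieDerivation.ad K L y : LieDerivation K L L) : L →ₗ[K] L)
      = (LieModule.toEnd K L L y : L →ₗ[K] L) := by ext z; simp
  rw [hy] at hc
  simp only [LinearMap.comp_apply, LinearMap.zero_apply] at h hc
  simp only [LinearMap.comp_apply, ceD_ι_mul, map_sub, hc, h, LinearMap.zero_apply]
  simp

theorem ceD_mem (k : ℕ) {w : ExteriorAlgebra K L} (hw : w ∈ ⋀[K]^(k + 1) L) :
    ceD K L w ∈ ⋀[K]^k L := by
  induction k generalizing w with
  | zero =>
    rw [exteriorPower, zero_add, pow_one] at hw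
    obtain ⟨x, rfl⟩ := hw
    rw [← mul_one (ι K x), ceD_ι_mul]
    simp
  | succ k ih =>
    rw [exteriorPower, pow_succ'] at hw
    induction hw using Submodule.mul_induction_on' with
    | mem_mul_mem m hm n hn =>
      obtain ⟨y, rfl⟩ := hm
      rw [ceD_ι_mul]
      refine sub_mem (extDer_mem _ _ hn) ?_
      rw [exteriorPower, pow_succ']
      exact Submodule.mul_mem_mul ⟨_, rfl⟩ (ih hn)
    | add x _ y _ hx hy => rw [map_add]; exact add_mem hx hy

variable (K L)

/-- The `k`-cycles: the kernel of the differential on `Λᵏ L`. -/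
def cycles (k : ℕ) : Submodule K (ExteriorAlgebra K L) := ⋀[K]^k L ⊓ LinearMap.ker (ceD K L)

/-- The `k`-boundaries: the image of `Λᵏ⁺¹ L` under the differential. -/
def boundaries (k : ℕ) : Submodule K (ExteriorAlgebra K L) := (⋀[K]^(k + 1) L).map (ceD K L)

theorem boundaries_le_cycles (k : ℕ) : boundaries K L k ≤ cycles K L k := by
  rintro _ ⟨w, hw, rfl⟩
  exact ⟨ceD_mem k hw, LinearMap.congr_fun ceD_comp_ceD w⟩

/-- The homology `H_k(L) = H_k(L, K)` of the Lie algebra `L` with trivial coefficients. -/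
abbrev H (k : ℕ) : Type _ := cycles K L k ⧸ (boundaries K L k).submoduleOf (cycles K L k)

variable {K L}

theorem extDer_mem_cycles (D : LieDerivation K L L) (k : ℕ) :
    cycles K L k ≤ (cycles K L k).comap (extDer (D : L →ₗ[K] L)) := by
  rintro w ⟨hw, hz⟩
  refine ⟨extDer_mem _ _ hw, ?_⟩
  have := LinearMap.congr_fun (ceD_comp_extDer D) w
  simp only [LinearMap.comp_apply] at this
  exact LinearMap.mem_ker.2 (by rw [this, LinearMap.mem_ker.1 hz, map_zero])

/-- The endomorphism of `H_k(L)` induced by a derivation `D` of the Lie algebra `L`. -/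
def derH (D : LieDerivation K L L) (k : ℕ) : H K L k →ₗ[K] H K L k :=
  Submodule.mapQ _ _ ((extDer (D : L →ₗ[K] L)).restrict (extDer_mem_cycles D k)) (by
    rintro ⟨w, hw⟩ ⟨v, hv, hvw⟩
    refine ⟨extDer (D : L →ₗ[K] L) v, extDer_mem _ _ hv, ?_⟩
    have := LinearMap.congr_fun (ceD_comp_extDer D) v
    simp only [LinearMap.comp_apply] at this
    rw [this, hvw]
    rfl)

/-- The invariants of `H_k(L)` for the action on homology that is induced by an action `ρ` of a
Lie algebra `S` on `L` by derivations. -/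
def invariants {S : Type*} [LieRing S] [LieAlgebra K S] (ρ : S →ₗ⁅K⁆ LieDerivation K L L)
    (k : ℕ) : Submodule K (H K L k) :=
  ⨅ s : S, LinearMap.ker (derH (ρ s) k)

end LieHomology

/-! ### The Tits–Allison–Gao Lie algebra of a Jordan algebra -/

namespace TAG

/-- The Lie algebra `sl₂` of traceless `2 × 2` matrices. -/
abbrev sl2 (K : Type*) [CommRing K] : Type _ := LieAlgebra.SpecialLinear.sl (Fin 2) K

variable (K : Type*) [Field K]

/-- The invariant form `κ(x, y) = ½ Tr (ad x ∘ ad y)` on `sl₂`. -/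
def kappa : sl2 K →ₗ[K] sl2 K →ₗ[K] K := (2⁻¹ : K) • killingForm K (sl2 K)

/-- Coordinates on `sl₂` for the basis `e, f, h`. -/
def sl2Equiv : sl2 K ≃ₗ[K] (Fin 3 → K) where
  toFun x := ![x.1 0 1, x.1 1 0, x.1 0 0]
  map_add' x y := by ext i; fin_cases i <;> rfl
  map_smul' t x := by ext i; fin_cases i <;> rfl
  invFun v := ⟨!![v 2, v 0; v 1, - v 2], by
    change Matrix.trace !![v 2, v 0; v 1, - v 2] = 0
    simp [Matrix.trace_fin_two]⟩
  left_inv x := by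
    have h : Matrix.trace x.1 = 0 := x.2
    rw [Matrix.trace_fin_two] at h
    ext i j
    fin_cases i <;> fin_cases j <;> simp
    linear_combination -h
  right_inv v := by ext i; fin_cases i <;> simp

variable {K}

theorem sl2_apply_one_one (x : sl2 K) : x.1 1 1 = - x.1 0 0 := by
  have h : Matrix.trace x.1 = 0 := x.2
  rw [Matrix.trace_fin_two] at h
  linear_combination h

theorem kappa_apply [CharZero K] (x y : sl2 K) :
    kappa K x y = 2 * Matrix.trace (x.1 * y.1) := by
  have hx := sl2_apply_one_one x
  have hy := sl2_apply_one_one y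
  rw [kappa, LinearMap.smul_apply, LinearMap.smul_apply, killingForm_apply_apply,
    LinearMap.trace_eq_matrix_trace K (Module.Basis.ofEquivFun (sl2Equiv K)), Matrix.trace_fin_three]
  simp only [LinearMap.toMatrix_apply, Module.Basis.ofEquivFun_repr_apply,
    Module.Basis.coe_ofEquivFun, LinearMap.comp_apply, LieAlgebra.ad_apply, sl2Equiv,
    LinearEquiv.coe_mk, LinearMap.coe_mk, AddHom.coe_mk, LieAlgebra.SpecialLinear.sl_bracket]
  simp [Matrix.mul_apply, Fin.sum_univ_two, Matrix.vecMul, dotProduct, hx, hy,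
    Matrix.trace_fin_two]
  ring

theorem kappa_symm [CharZero K] (x y : sl2 K) : kappa K x y = kappa K y x := by
  rw [kappa_apply, kappa_apply, Matrix.trace_mul_comm]

theorem lie_lie_sl2 [CharZero K] (x y z : sl2 K) :
    ⁅x, ⁅y, z⁆⁆ = kappa K x y • z - kappa K x z • y := by
  have hx := sl2_apply_one_one x
  have hy := sl2_apply_one_one y
  have hz := sl2_apply_one_one z
  have e : (⁅x, ⁅y, z⁆⁆ : sl2 K).1 = x.1 * (y.1 * z.1 - z.1 * y.1) - (y.1 * z.1 - z.1 * y.1) * x.1 :=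
    rfl
  rw [kappa_apply, kappa_apply]
  ext i j
  rw [e]
  fin_cases i <;> fin_cases j <;>
    simp [Matrix.mul_apply, Fin.sum_univ_two, Matrix.trace_fin_two, hx, hy, hz] <;> ring

theorem kappa_lie [CharZero K] (x y z : sl2 K) : kappa K x ⁅y, z⁆ = kappa K ⁅x, y⁆ z := by
  rw [kappa_apply, kappa_apply]
  simp only [LieAlgebra.SpecialLinear.sl_bracket, mul_sub, sub_mul, Matrix.trace_sub]
  rw [← mul_assoc, ← mul_assoc, Matrix.trace_mul_cycle x.1 z.1 y.1]


/-! #### Inner derivations and the space `BJ` -/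

section Jordan

variable {J : Type*} [NonUnitalNonAssocCommRing J] [Module K J] [IsScalarTower K J J]
  [SMulCommClass K J J]

variable (K J) in
/-- `innerDer K J a b` is the map `∂_{a,b} : z ↦ a(zb) - (az)b`. -/
def innerDer : J →ₗ[K] J →ₗ[K] J →ₗ[K] J :=
  LinearMap.mk₂ K (fun a b =>
      { toFun := fun z => a * (z * b) - (a * z) * b
        map_add' := fun _ _ => by simp only [mul_add, add_mul]; abel
        map_smul' := fun _ _ => by
          simp only [smul_mul_assoc, mul_smul_comm, smul_sub, RingHom.id_apply] })
    (fun _ _ _ => by ext z; simp only [LinearMap.coe_mk, AddHom.coe_mk, LinearMap.add_apply, add_mul]; abel)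
    (fun _ _ _ => by ext z; simp [smul_sub, smul_mul_assoc])
    (fun _ _ _ => by ext z; simp only [LinearMap.coe_mk, AddHom.coe_mk, LinearMap.add_apply, mul_add]; abel)
    (fun _ _ _ => by ext z; simp [smul_sub, mul_smul_comm])

theorem innerDer_apply (a b z : J) : innerDer K J a b z = a * (z * b) - (a * z) * b := rfl

theorem innerDer_apply' (a b z : J) : innerDer K J a b z = a * (b * z) - b * (a * z) := by
  rw [innerDer_apply, mul_comm z b, mul_comm (a * z) b]

theorem update_zero {α : Type*} (a b x : α) : Function.update ![a, b] 0 x = ![x, b] := by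
  ext i; fin_cases i <;> rfl

theorem update_one {α : Type*} (a b x : α) : Function.update ![a, b] 1 x = ![a, x] := by
  ext i; fin_cases i <;> rfl

variable (K J) in
/-- The map `(a, b) ↦ a ∧ b ∈ Λ² J`. -/
def wedge : J →ₗ[K] J →ₗ[K] ⋀[K]^2 J :=
  LinearMap.mk₂ K (fun a b => exteriorPower.ιMulti K 2 ![a, b])
    (fun a a' b => by
      simpa only [update_zero, update_one] using
        (exteriorPower.ιMulti K 2 (M := J)).map_update_add ![a, b] 0 a a')
    (fun t a b => by
      simpa only [update_zero, update_one] using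
        (exteriorPower.ιMulti K 2 (M := J)).map_update_smul ![a, b] 0 t a)
    (fun a b b' => by
      simpa only [update_zero, update_one] using
        (exteriorPower.ιMulti K 2 (M := J)).map_update_add ![a, b] 1 b b')
    (fun t a b => by
      simpa only [update_zero, update_one] using
        (exteriorPower.ιMulti K 2 (M := J)).map_update_smul ![a, b] 1 t b)

variable (K J) in
/-- The linear span `R(J) ⊆ Λ² J` of all `a ∧ a²`. -/
def relB : Submodule K (⋀[K]^2 J) := Submodule.span K (Set.range fun a : J => wedge K J a (a * a))

variable (K J) in
/-- The space `BJ = Λ² J / R(J)`. -/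
abbrev B : Type _ := (⋀[K]^2 J) ⧸ relB K J

section lift
variable {N : Type*} [AddCommGroup N] [Module K N]

/-- The alternating map given by an alternating bilinear map. -/
def altOfBilin (f : J →ₗ[K] J →ₗ[K] N) (h : ∀ a, f a a = 0) : J [⋀^Fin 2]→ₗ[K] N where
  toFun v := f (v 0) (v 1)
  map_update_add' := by
    intro _ v i x y
    fin_cases i <;> simp [Function.update]
  map_update_smul' := by
    intro _ v i t x
    fin_cases i <;> simp [Function.update]
  map_eq_zero_of_eq' := by
    intro v i j hv hij
    have : v 0 = v 1 := by
      fin_cases i <;> fin_cases j <;> simp_all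
    rw [this, h]

/-- The linear map on `BJ` induced by an alternating bilinear map `f` with `f(a, a²) = 0`. -/
def liftB (f : J →ₗ[K] J →ₗ[K] N) (h : ∀ a, f a a = 0) (h' : ∀ a, f a (a * a) = 0) :
    B K J →ₗ[K] N :=
  (relB K J).liftQ (exteriorPower.alternatingMapLinearEquiv (altOfBilin f h)) (by
    rw [relB, Submodule.span_le]
    rintro _ ⟨a, rfl⟩
    exact (exteriorPower.alternatingMapLinearEquiv_apply_ιMulti (altOfBilin f h) ![a, a * a]).trans
      (h' a))

end lift

variable (K J) in
/-- The class `{a ∧ b}` in `BJ`, as a bilinear map. -/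
def cls : J →ₗ[K] J →ₗ[K] B K J := (wedge K J).compr₂ (relB K J).mkQ

theorem cls_self (a : J) : cls K J a a = 0 := by
  have h : wedge K J a a = 0 :=
    (exteriorPower.ιMulti K 2 (M := J)).map_eq_zero_of_eq ![a, a] (i := 0) (j := 1) rfl (by simp)
  change (relB K J).mkQ (wedge K J a a) = 0
  rw [h, map_zero]

theorem cls_sq (a : J) : cls K J a (a * a) = 0 :=
  (Submodule.Quotient.mk_eq_zero _).2 (Submodule.subset_span ⟨a, rfl⟩)

@[simp] theorem liftB_cls {N : Type*} [AddCommGroup N] [Module K N] (f : J →ₗ[K] J →ₗ[K] N)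
    (h : ∀ a, f a a = 0) (h' : ∀ a, f a (a * a) = 0) (a b : J) :
    liftB f h h' (cls K J a b) = f a b :=
  exteriorPower.alternatingMapLinearEquiv_apply_ιMulti (altOfBilin f h) ![a, b]

theorem cls_induction {p : B K J → Prop} (cls' : ∀ a b, p (cls K J a b))
    (add : ∀ x y, p x → p y → p (x + y)) (smul : ∀ (t : K) x, p x → p (t • x)) (x : B K J) :
    p x := by
  obtain ⟨w, rfl⟩ := (relB K J).mkQ_surjective x
  have hw : w ∈ Submodule.span K (Set.range (exteriorPower.ιMulti K 2 (M := J))) := by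
    rw [exteriorPower.ιMulti_span]; trivial
  induction hw using Submodule.span_induction with
  | mem w hw =>
    obtain ⟨v, rfl⟩ := hw
    have : v = ![v 0, v 1] := by ext i; fin_cases i <;> rfl
    rw [this]
    exact cls' _ _
  | zero => rw [map_zero, ← zero_smul K (cls K J 0 0)]; exact smul _ _ (cls' _ _)
  | add x y _ _ hx hy => rw [map_add]; exact add _ _ hx hy
  | smul t x _ hx => rw [map_smul]; exact smul _ _ hx

theorem cls_skew (a b : J) : cls K J a b = - cls K J b a := by
  have h := cls_self (K := K) (a + b)
  simp only [map_add, LinearMap.add_apply, cls_self, zero_add, add_zero] at h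
  exact eq_neg_of_add_eq_zero_left (by rw [add_comm]; exact h)

/-- The polarization of `{c ∧ c²} = 0`. -/
theorem cls_polar [CharZero K] (c u : J) : cls K J u (c * c) + (2 : K) • cls K J c (c * u) = 0 := by
  have h1 := cls_sq (K := K) (c + u)
  have h2 := cls_sq (K := K) (c - u)
  have h3 := cls_sq (K := K) u
  have h4 := cls_sq (K := K) c
  simp only [mul_add, add_mul, mul_sub, sub_mul, map_add, map_sub, LinearMap.add_apply,
    LinearMap.sub_apply, mul_comm u c, h3, h4] at h1 h2
  have h2' : (2 : K) ≠ 0 := two_ne_zero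
  have : (2 : K) • (cls K J u (c * c) + (2 : K) • cls K J c (c * u)) = 0 := by
    linear_combination (norm := module) h1 - h2
  exact (smul_eq_zero.1 this).resolve_left h2'

/-- The full polarization of `{c ∧ c²} = 0`. -/
theorem cls_cyclic [CharZero K] (a b c : J) :
    cls K J a (b * c) + cls K J b (c * a) + cls K J c (a * b) = 0 := by
  have h1 := cls_polar (K := K) (b + c) a
  have h2 := cls_polar (K := K) b a
  have h3 := cls_polar (K := K) c a
  simp only [mul_add, add_mul, map_add, LinearMap.add_apply, mul_comm c b] at h1
  have h2' : (2 : K) ≠ 0 := two_ne_zero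
  have : (2 : K) • (cls K J a (b * c) + cls K J b (c * a) + cls K J c (a * b)) = 0 := by
    rw [mul_comm a b]
    linear_combination (norm := module) h1 - h2 - h3
  exact (smul_eq_zero.1 this).resolve_left h2'


theorem cls_leib [CharZero K] (a b c : J) :
    cls K J a (b * c) = cls K J (a * b) c + cls K J (a * c) b := by
  have h := cls_cyclic (K := K) a b c
  rw [cls_skew b, cls_skew c (a * b), mul_comm c a] at h
  linear_combination (norm := module) h

variable [IsCommJordan J]

/-- The linearized Jordan identity. -/
theorem jordan_linear [CharZero K] (a b c z : J) :
    a * ((b * c) * z) - (b * c) * (a * z) + (b * ((c * a) * z) - (c * a) * (b * z)) +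
      (c * ((a * b) * z) - (a * b) * (c * z)) = 0 := by
  have h := DFunLike.congr_fun (two_nsmul_lie_lmul_lmul_add_add_eq_zero a b c) z
  have h' : (2 : K) • (a * ((b * c) * z) - (b * c) * (a * z) + (b * ((c * a) * z)
      - (c * a) * (b * z)) + (c * ((a * b) * z) - (a * b) * (c * z))) = 0 := by
    rw [ofNat_smul_eq_nsmul]
    exact h
  exact (smul_eq_zero.1 h').resolve_left two_ne_zero

/-- `∂_{a,b}` is a derivation of `J`. -/
theorem innerDer_mul [CharZero K] (a b x y : J) :
    innerDer K J a b (x * y) = innerDer K J a b x * y + x * innerDer K J a b y := by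
  have h1 := jordan_linear (K := K) b x y a
  have h2 := jordan_linear (K := K) a x y b
  simp only [innerDer_apply', sub_mul, mul_sub]
  simp only [mul_comm] at h1 h2 ⊢
  linear_combination (norm := abel) h2 - h1

theorem hom_ext {N : Type*} [AddCommGroup N] [Module K N] {f g : B K J →ₗ[K] N}
    (h : ∀ a b, f (cls K J a b) = g (cls K J a b)) : f = g := by
  refine LinearMap.ext fun x => ?_
  induction x using cls_induction with
  | cls' a b => exact h a b
  | add x y hx hy => rw [map_add, map_add, hx, hy]
  | smul t x hx => rw [map_smul, map_smul, hx]

variable [CharZero K]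

variable (K J) in
/-- The map `{ω} ↦ ∂_ω` from `BJ` to the inner derivations of `J`. -/
def toInner : B K J →ₗ[K] J →ₗ[K] J :=
  liftB (innerDer K J)
    (fun a => by ext z; rw [innerDer_apply', sub_self]; rfl)
    (fun a => by ext z; rw [innerDer_apply', IsJordan.lmul_lmul_comm_lmul, sub_self]; rfl)

@[simp] theorem toInner_cls (a b : J) : toInner K J (cls K J a b) = innerDer K J a b := liftB_cls ..

theorem toInner_mul (ω : B K J) (x y : J) :
    toInner K J ω (x * y) = toInner K J ω x * y + x * toInner K J ω y := by
  induction ω using cls_induction with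
  | cls' a b => rw [toInner_cls, innerDer_mul]
  | add ω ω' h h' => simp only [map_add, LinearMap.add_apply, h, h', add_mul, mul_add]; abel
  | smul t ω h => simp only [map_smul, LinearMap.smul_apply, h, smul_mul_assoc, mul_smul_comm,
      smul_add]

/-- The endomorphism `{a ∧ b} ↦ {φ a ∧ b} + {a ∧ φ b}` of `BJ` given by a derivation `φ` of `J`. -/
def derB (φ : J →ₗ[K] J) (hφ : ∀ x y, φ (x * y) = φ x * y + x * φ y) : B K J →ₗ[K] B K J :=
  liftB ((cls K J).comp φ + (cls K J).compl₂ φ)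
    (fun a => by
      simp only [LinearMap.add_apply, LinearMap.comp_apply, LinearMap.compl₂_apply]
      rw [cls_skew, neg_add_cancel])
    (fun a => by
      have h := cls_polar (K := K) a (φ a)
      simp only [LinearMap.add_apply, LinearMap.comp_apply, LinearMap.compl₂_apply, hφ, map_add]
      rw [mul_comm (φ a) a]
      linear_combination (norm := module) h)

variable (K J) in
/-- The bracket `[{ω}, {ω'}] = ∂_ω . {ω'}` on `BJ`. -/
def bracketB : B K J →ₗ[K] B K J →ₗ[K] B K J where
  toFun ω := derB (toInner K J ω) (toInner_mul ω)
  map_add' ω ω' := hom_ext fun a b => by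
    simp only [derB, liftB_cls, LinearMap.add_apply, LinearMap.comp_apply, LinearMap.compl₂_apply,
      map_add]
    abel
  map_smul' t ω := hom_ext fun a b => by
    simp only [derB, liftB_cls, LinearMap.add_apply, LinearMap.comp_apply, LinearMap.compl₂_apply,
      map_smul, LinearMap.smul_apply, RingHom.id_apply, smul_add]

theorem bracketB_cls (ω : B K J) (a b : J) :
    bracketB K J ω (cls K J a b) = cls K J (toInner K J ω a) b + cls K J a (toInner K J ω b) := by
  change derB _ (toInner_mul ω) _ = _
  rw [derB, liftB_cls]
  rfl

theorem bracketB_skew (ω ω' : B K J) : bracketB K J ω ω' = - bracketB K J ω' ω := by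
  induction ω using cls_induction with
  | add x y hx hy => rw [map_add, map_add, LinearMap.add_apply, hx, hy, neg_add]
  | smul t x hx => rw [map_smul, map_smul, LinearMap.smul_apply, hx, smul_neg]
  | cls' a b =>
    induction ω' using cls_induction with
    | add x y hx hy => rw [map_add, map_add, LinearMap.add_apply, hx, hy, neg_add]
    | smul t x hx => rw [map_smul, map_smul, LinearMap.smul_apply, hx, smul_neg]
    | cls' c d =>
      simp only [bracketB_cls, toInner_cls, innerDer_apply', map_sub, LinearMap.sub_apply]
      have h1 := cls_leib (K := K) d a (b * c)
      have h2 := cls_leib (K := K) d b (a * c)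
      have h3 := cls_leib (K := K) c a (b * d)
      have h4 := cls_leib (K := K) c b (a * d)
      have s1 := cls_skew (K := K) (a * (b * c)) d
      have s2 := cls_skew (K := K) (b * (a * c)) d
      have s3 := cls_skew (K := K) (c * (d * a)) b
      have s4 := cls_skew (K := K) (d * (c * a)) b
      have s5 := cls_skew (K := K) (d * (b * c)) a
      have s6 := cls_skew (K := K) (d * (a * c)) b
      have s7 := cls_skew (K := K) (c * (b * d)) a
      have s8 := cls_skew (K := K) (c * (a * d)) b
      have s9 := cls_skew (K := K) (d * a) (b * c)
      have s10 := cls_skew (K := K) (d * b) (a * c)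
      simp only [mul_comm] at h1 h2 h3 h4 s1 s2 s3 s4 s5 s6 s7 s8 s9 s10 ⊢
      linear_combination (norm := module) s1 - s2 + s3 - s4 - h1 + h2 + h3 - h4 - s5 + s6 + s7
        - s8 - s9 + s10

theorem toInner_bracketB (ω ω' : B K J) (z : J) :
    toInner K J (bracketB K J ω ω') z =
      toInner K J ω (toInner K J ω' z) - toInner K J ω' (toInner K J ω z) := by
  induction ω' using cls_induction with
  | add x y hx hy => simp only [map_add, LinearMap.add_apply, hx, hy]; abel
  | smul t x hx => simp only [map_smul, LinearMap.smul_apply, hx, smul_sub]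
  | cls' a b =>
    simp only [bracketB_cls, map_add, toInner_cls, LinearMap.add_apply, innerDer_apply', map_sub,
      toInner_mul, mul_add]
    abel

theorem bracketB_leib (ω₁ ω₂ ω₃ : B K J) :
    bracketB K J ω₁ (bracketB K J ω₂ ω₃) =
      bracketB K J (bracketB K J ω₁ ω₂) ω₃ + bracketB K J ω₂ (bracketB K J ω₁ ω₃) := by
  induction ω₃ using cls_induction with
  | add x y hx hy => simp only [map_add, hx, hy]; abel
  | smul t x hx => simp only [map_smul, hx, smul_add]
  | cls' a b =>
    simp only [bracketB_cls, map_add, toInner_bracketB, map_sub, LinearMap.sub_apply]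
    abel

variable (K J) in
/-- The action of `BJ` on `sl₂ ⊗ J`: `[{ω}, x(a)] = x(∂_ω a)`. -/
def actS : B K J →ₗ[K] (sl2 K ⊗[K] J) →ₗ[K] (sl2 K ⊗[K] J) :=
  (LinearMap.lTensorHom (sl2 K)).comp (toInner K J)

@[simp] theorem actS_tmul (ω : B K J) (x : sl2 K) (a : J) :
    actS K J ω (x ⊗ₜ a) = x ⊗ₜ toInner K J ω a := rfl

variable (K J) in
/-- The `sl₂ ⊗ J`-component `(x(a), y(b)) ↦ [x, y](ab)` of the bracket on `sl₂ ⊗ J`. -/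
def mulS : (sl2 K ⊗[K] J) →ₗ[K] (sl2 K ⊗[K] J) →ₗ[K] (sl2 K ⊗[K] J) :=
  TensorProduct.map₂ (LieModule.toEnd K (sl2 K) (sl2 K) : sl2 K →ₗ[K] sl2 K →ₗ[K] sl2 K)
    (LinearMap.mul K J)

@[simp] theorem mulS_tmul (x y : sl2 K) (a b : J) :
    mulS K J (x ⊗ₜ a) (y ⊗ₜ b) = ⁅x, y⁆ ⊗ₜ (a * b) := rfl

variable (K J) in
/-- The `BJ`-component `(x(a), y(b)) ↦ κ(x, y) {a ∧ b}` of the bracket on `sl₂ ⊗ J`. -/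
def formS : (sl2 K ⊗[K] J) →ₗ[K] (sl2 K ⊗[K] J) →ₗ[K] B K J :=
  (TensorProduct.map₂ (kappa K) (cls K J)).compr₂ (TensorProduct.lid K (B K J)).toLinearMap

@[simp] theorem formS_tmul (x y : sl2 K) (a b : J) :
    formS K J (x ⊗ₜ a) (y ⊗ₜ b) = kappa K x y • cls K J a b := rfl

theorem mulS_skew (s t : sl2 K ⊗[K] J) : mulS K J s t = - mulS K J t s := by
  induction s with
  | zero => simp
  | add x y hx hy => rw [map_add, map_add, LinearMap.add_apply, hx, hy, neg_add]
  | tmul x a =>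
    induction t with
    | zero => simp
    | add x y hx hy => rw [map_add, map_add, LinearMap.add_apply, hx, hy, neg_add]
    | tmul y b => rw [mulS_tmul, mulS_tmul, ← lie_skew, TensorProduct.neg_tmul, mul_comm]

theorem formS_skew (s t : sl2 K ⊗[K] J) : formS K J s t = - formS K J t s := by
  induction s with
  | zero => simp
  | add x y hx hy => rw [map_add, map_add, LinearMap.add_apply, hx, hy, neg_add]
  | tmul x a =>
    induction t with
    | zero => simp
    | add x y hx hy => rw [map_add, map_add, LinearMap.add_apply, hx, hy, neg_add]
    | tmul y b => rw [formS_tmul, formS_tmul, cls_skew, kappa_symm, smul_neg]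

theorem actS_bracketB (ω ω' : B K J) (s : sl2 K ⊗[K] J) :
    actS K J (bracketB K J ω ω') s = actS K J ω (actS K J ω' s) - actS K J ω' (actS K J ω s) := by
  induction s with
  | zero => simp
  | add x y hx hy => simp only [map_add, hx, hy]; abel
  | tmul x a => simp only [actS_tmul, toInner_bracketB, TensorProduct.tmul_sub]

theorem actS_mulS (ω : B K J) (s t : sl2 K ⊗[K] J) :
    actS K J ω (mulS K J s t) = mulS K J (actS K J ω s) t + mulS K J s (actS K J ω t) := by
  induction s with
  | zero => simp
  | add x y hx hy => simp only [map_add, LinearMap.add_apply, hx, hy]; abel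
  | tmul x a =>
    induction t with
    | zero => simp
    | add x y hx hy => simp only [map_add, hx, hy]; abel
    | tmul y b => simp only [mulS_tmul, actS_tmul, toInner_mul, TensorProduct.tmul_add]

theorem bracketB_formS (ω : B K J) (s t : sl2 K ⊗[K] J) :
    bracketB K J ω (formS K J s t) = formS K J (actS K J ω s) t + formS K J s (actS K J ω t) := by
  induction s with
  | zero => simp
  | add x y hx hy => simp only [map_add, LinearMap.add_apply, hx, hy]; abel
  | tmul x a =>
    induction t with
    | zero => simp
    | add x y hx hy => simp only [map_add, hx, hy]; abel
    | tmul y b => simp only [formS_tmul, actS_tmul, map_smul, bracketB_cls, smul_add]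

theorem mulS_leib (s t u : sl2 K ⊗[K] J) :
    mulS K J s (mulS K J t u) - actS K J (formS K J t u) s =
      mulS K J (mulS K J s t) u + actS K J (formS K J s t) u +
        (mulS K J t (mulS K J s u) - actS K J (formS K J s u) t) := by
  induction s with
  | zero => simp
  | add x y hx hy =>
    simp only [map_add, LinearMap.add_apply]
    linear_combination (norm := module) hx + hy
  | tmul x a =>
    induction t with
    | zero => simp
    | add x y hx hy =>
      simp only [map_add, LinearMap.add_apply]
      linear_combination (norm := module) hx + hy
    | tmul y b =>
      induction u with
      | zero => simp
      | add x y hx hy =>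
        simp only [map_add, LinearMap.add_apply]
        linear_combination (norm := module) hx + hy
      | tmul z c =>
        have h : ⁅⁅x, y⁆, z⁆ = kappa K z y • x - kappa K z x • y := by
          rw [← lie_skew, lie_lie_sl2]; abel
        simp only [mulS_tmul, formS_tmul, map_smul, LinearMap.smul_apply, actS_tmul, toInner_cls,
          innerDer_apply', h, lie_lie_sl2, TensorProduct.sub_tmul, ← TensorProduct.smul_tmul',
          TensorProduct.tmul_sub, kappa_symm z, kappa_symm y x]
        simp only [mul_comm]
        module

theorem formS_leib (s t u : sl2 K ⊗[K] J) :
    formS K J s (mulS K J t u) = formS K J (mulS K J s t) u + formS K J t (mulS K J s u) := by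
  induction s with
  | zero => simp
  | add x y hx hy =>
    simp only [map_add, LinearMap.add_apply]
    linear_combination (norm := module) hx + hy
  | tmul x a =>
    induction t with
    | zero => simp
    | add x y hx hy =>
      simp only [map_add, LinearMap.add_apply]
      linear_combination (norm := module) hx + hy
    | tmul y b =>
      induction u with
      | zero => simp
      | add x y hx hy =>
        simp only [map_add]
        linear_combination (norm := module) hx + hy
      | tmul z c =>
        have h1 : kappa K y ⁅x, z⁆ = - kappa K ⁅x, y⁆ z := by
          rw [kappa_lie, ← lie_skew, map_neg, LinearMap.neg_apply]
        have h2 := cls_leib (K := K) a b c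
        have h3 := cls_skew (K := K) (a * c) b
        simp only [mulS_tmul, formS_tmul, kappa_lie x y z, h1, h2]
        rw [h3]
        module

end Jordan

end TAG

variable (K J : Type*) [Field K] [CharZero K] [NonUnitalNonAssocCommRing J] [Module K J]
  [IsScalarTower K J J] [SMulCommClass K J J] [IsCommJordan J]

/-- The Tits–Allison–Gao Lie algebra `TAG(J) = sl₂ J = BJ ⊕ (sl₂ ⊗ J)` of a Jordan algebra `J`. -/
@[ext] structure TAG where
  /-- The component in `BJ`. -/
  fst : TAG.B K J
  /-- The component in `sl₂ ⊗ J`. -/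
  snd : TAG.sl2 K ⊗[K] J

namespace TAG

variable {K J}

/-- The underlying vector space of `TAG(J)` is `BJ × (sl₂ ⊗ J)`. -/
def equivProd : TAG K J ≃ B K J × (sl2 K ⊗[K] J) where
  toFun u := (u.1, u.2)
  invFun p := ⟨p.1, p.2⟩

instance : AddCommGroup (TAG K J) := equivProd.addCommGroup
instance : Module K (TAG K J) := equivProd.module K

@[simp] theorem add_fst (u v : TAG K J) : (u + v).fst = u.fst + v.fst := rfl
@[simp] theorem add_snd (u v : TAG K J) : (u + v).snd = u.snd + v.snd := rfl
@[simp] theorem zero_fst : (0 : TAG K J).fst = 0 := rfl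
@[simp] theorem zero_snd : (0 : TAG K J).snd = 0 := rfl
@[simp] theorem sub_fst (u v : TAG K J) : (u - v).fst = u.fst - v.fst := rfl
@[simp] theorem sub_snd (u v : TAG K J) : (u - v).snd = u.snd - v.snd := rfl
@[simp] theorem smul_fst (t : K) (u : TAG K J) : (t • u).fst = t • u.fst := rfl
@[simp] theorem smul_snd (t : K) (u : TAG K J) : (t • u).snd = t • u.snd := rfl

/-- The bracket of `TAG(J)`:
`[x(a), y(b)] = [x, y](ab) + κ(x, y) {a ∧ b}`, `[{ω}, x(a)] = x(∂_ω a)`,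
`[{ω}, {ω'}] = ∂_ω . {ω'}`. -/
instance : Bracket (TAG K J) (TAG K J) where
  bracket u v :=
    { fst := bracketB K J u.fst v.fst + formS K J u.snd v.snd
      snd := actS K J u.fst v.snd - actS K J v.fst u.snd + mulS K J u.snd v.snd }

@[simp] theorem lie_fst (u v : TAG K J) :
    ⁅u, v⁆.fst = bracketB K J u.fst v.fst + formS K J u.snd v.snd := rfl
@[simp] theorem lie_snd (u v : TAG K J) :
    ⁅u, v⁆.snd = actS K J u.fst v.snd - actS K J v.fst u.snd + mulS K J u.snd v.snd := rfl

theorem eq_zero_of_eq_neg {V : Type*} [AddCommGroup V] [Module K V] {v : V} (h : v = -v) :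
    v = 0 := by
  have h2 : (2 : K) • v = 0 := by linear_combination (norm := module) h
  exact (smul_eq_zero.1 h2).resolve_left two_ne_zero

instance : LieRing (TAG K J) where
  add_lie u v w := by ext <;> simp <;> abel
  lie_add u v w := by ext <;> simp <;> abel
  lie_self u := by
    ext
    · rw [lie_fst, eq_zero_of_eq_neg (K := K) (bracketB_skew u.fst u.fst),
        eq_zero_of_eq_neg (K := K) (formS_skew u.snd u.snd), add_zero]; rfl
    · rw [lie_snd, eq_zero_of_eq_neg (K := K) (mulS_skew u.snd u.snd), sub_self, add_zero]; rfl
  leibniz_lie u v w := by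
    ext
    · have h1 := bracketB_leib u.fst v.fst w.fst
      have h2 := bracketB_formS u.fst v.snd w.snd
      have h3 := bracketB_formS v.fst u.snd w.snd
      have h4 := bracketB_formS w.fst u.snd v.snd
      have h5 := formS_leib u.snd v.snd w.snd
      have h6 := bracketB_skew (formS K J u.snd v.snd) w.fst
      have h7 := formS_skew (actS K J w.fst u.snd) v.snd
      simp only [lie_fst, lie_snd, add_fst, map_add, map_sub, LinearMap.add_apply,
        LinearMap.sub_apply, h6]
      linear_combination (norm := module) h1 + h2 + h5 - h3 + h4 + h7
    · have h1 := actS_bracketB u.fst v.fst w.snd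
      have h2 := actS_bracketB u.fst w.fst v.snd
      have h3 := actS_bracketB v.fst w.fst u.snd
      have h4 := actS_mulS u.fst v.snd w.snd
      have h5 := actS_mulS v.fst u.snd w.snd
      have h6 := actS_mulS w.fst u.snd v.snd
      have h7 := mulS_leib u.snd v.snd w.snd
      have h8 := mulS_skew (actS K J w.fst u.snd) v.snd
      simp only [lie_fst, lie_snd, add_snd, map_add, map_sub, LinearMap.add_apply,
        LinearMap.sub_apply]
      linear_combination (norm := module) h7 - h1 + h2 + h4 - h3 - h5 + h6 + h8

instance : LieAlgebra K (TAG K J) where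
  lie_smul t u v := by ext <;> simp [smul_sub]

variable (K J) in
/-- The map `y(a) ↦ [x, y](a)` on `sl₂ ⊗ J`, for `x ∈ sl₂`. -/
def adS (x : sl2 K) : (sl2 K ⊗[K] J) →ₗ[K] (sl2 K ⊗[K] J) :=
  LinearMap.rTensor J (LieModule.toEnd K (sl2 K) (sl2 K) x : sl2 K →ₗ[K] sl2 K)

@[simp] theorem adS_tmul (x y : sl2 K) (a : J) : adS K J x (y ⊗ₜ a) = ⁅x, y⁆ ⊗ₜ a := rfl

theorem adS_actS (x : sl2 K) (ω : B K J) (s : sl2 K ⊗[K] J) :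
    adS K J x (actS K J ω s) = actS K J ω (adS K J x s) := by
  induction s with
  | zero => simp
  | add x y hx hy => simp only [map_add, hx, hy]
  | tmul y a => simp

theorem adS_mulS (x : sl2 K) (s t : sl2 K ⊗[K] J) :
    adS K J x (mulS K J s t) = mulS K J (adS K J x s) t + mulS K J s (adS K J x t) := by
  induction s with
  | zero => simp
  | add x y hx hy => simp only [map_add, LinearMap.add_apply, hx, hy]; abel
  | tmul y a =>
    induction t with
    | zero => simp
    | add x y hx hy => simp only [map_add, hx, hy]; abel
    | tmul z b => simp only [mulS_tmul, adS_tmul, leibniz_lie x y z, TensorProduct.add_tmul]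

theorem formS_adS (x : sl2 K) (s t : sl2 K ⊗[K] J) :
    formS K J (adS K J x s) t + formS K J s (adS K J x t) = 0 := by
  induction s with
  | zero => simp
  | add x y hx hy =>
    simp only [map_add, LinearMap.add_apply]
    linear_combination (norm := module) hx + hy
  | tmul y a =>
    induction t with
    | zero => simp
    | add x y hx hy =>
      simp only [map_add]
      linear_combination (norm := module) hx + hy
    | tmul z b =>
      simp only [formS_tmul, adS_tmul]
      rw [kappa_lie y x z, ← lie_skew y x, map_neg, LinearMap.neg_apply, neg_smul,
        add_neg_cancel]

theorem adS_add (x y : sl2 K) : adS K J (x + y) = adS K J x + adS K J y := by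
  simp [adS, LinearMap.rTensor_add]

theorem adS_smul (t : K) (x : sl2 K) : adS K J (t • x) = t • adS K J x := by
  simp [adS, LinearMap.rTensor_smul]

theorem adS_lie (x y : sl2 K) (s : sl2 K ⊗[K] J) :
    adS K J ⁅x, y⁆ s = adS K J x (adS K J y s) - adS K J y (adS K J x s) := by
  induction s with
  | zero => simp
  | add x y hx hy => simp only [map_add, hx, hy]; abel
  | tmul z a => simp only [adS_tmul, lie_lie, TensorProduct.sub_tmul]

variable (K J) in
/-- The action of `sl₂` on `TAG(J)` by derivations: `sl₂` acts on `BJ` trivially and on `sl₂ ⊗ J`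
through the adjoint action on the factor `sl₂`. -/
def sl2Action : sl2 K →ₗ⁅K⁆ LieDerivation K (TAG K J) (TAG K J) where
  toFun x :=
    { toFun := fun u => ⟨0, adS K J x u.snd⟩
      map_add' := fun u v => by ext <;> simp
      map_smul' := fun t u => by ext <;> simp
      leibniz' := fun u v => by
        ext
        · have h1 := formS_adS x u.snd v.snd
          have h2 := formS_skew v.snd (adS K J x u.snd)
          simp only [LinearMap.coe_mk, AddHom.coe_mk, sub_fst, lie_fst, map_zero, zero_add, h2]
          linear_combination (norm := module) -h1
        · have h1 := mulS_skew v.snd (adS K J x u.snd)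
          simp only [LinearMap.coe_mk, AddHom.coe_mk, sub_snd, lie_snd, map_add, map_sub, map_zero,
            LinearMap.zero_apply, sub_zero, adS_actS, adS_mulS, h1]
          abel }
  map_add' x y := by
    ext u
    · exact (add_zero _).symm
    · exact LinearMap.congr_fun (adS_add x y) u.snd
  map_smul' t x := by
    ext u
    · exact (smul_zero _).symm
    · exact LinearMap.congr_fun (adS_smul t x) u.snd
  map_lie' {x y} := by
    ext u
    · exact (sub_zero _).symm
    · exact adS_lie x y u.snd

end TAG

end

/-! An invariant class that is not zero is detected by an invariant linear form on `Λ³`. The weights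
of `sl₂` on `Λ³` are at most 6 in absolute value, so a polynomial in the `sl₂`-triple projects onto
the invariants (`exists_invariant_projection`), and a linear form that separates a cycle from the
boundaries can be replaced by an invariant one (`exists_invariant_form`). It then suffices to show
that every invariant 3-cocycle `c` of `TAG(J)` is a coboundary when `J` is free.

By the invariant theory of `sl₂`, `c(x(a), y(b), z(d)) = κ([x,y], z) φ(a,b,d)` with `φ` symmetric,
and `c({ω}, x(a), y(b)) = κ(x,y) ψ(ω; a,b)` with `ψ` skew in `a, b`. The components with two
arguments in `BJ` and one in `sl₂ ⊗ J` vanish. The cocycle condition becomes a few identities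
between `φ`, `ψ` and the restriction of `c` to `BJ`.

Eliminating `ψ` from two of these identities shows that `φ`, read as a map `J × J → J*`, is a Jordan
2-cocycle: it defines a null extension of `J` by `J*` which is again a Jordan algebra. Over a free
`J` this extension splits (`exists_splitting`), so `φ(a,b,c) = β(ab,c) - β(a,bc) - β(b,ac)` for some
bilinear `β`. The alternating part of `β` contributes a cyclic sum. The symmetry of `φ` forces the
symmetric part to be associative, and the degree grading of `J` turns it into a cyclic sum as well
(`exists_alternating_of_assoc`). Hence `φ(a,b,c) = m(ab,c) + m(bc,a) + m(ca,b)` with `m` alternating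
(`exists_alternating`).

The form `κ ⊗ m` on `sl₂ ⊗ J`, with a form on `BJ` determined by `ψ` and `m`, is then a primitive of
`c` (`exists_primitive`). A coboundary vanishes on cycles, which is a contradiction. -/

noncomputable section

/-! ### The free Jordan algebra: induction and the universal property. -/

namespace FreeJordan

variable {K X : Type*} [Field K]

variable (K X) in
/-- The canonical projection onto the free Jordan algebra. -/
def mkHom : FreeNonUnitalNonAssocAlgebra K X →ₙₐ[K] FreeJordan K X where
  toFun := Quot.mk _
  map_smul' _ _ := rfl
  map_zero' := rfl
  map_add' _ _ := rfl
  map_mul' _ _ := rfl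

/-- Induction principle for the free Jordan algebra. -/
theorem induction {p : FreeJordan K X → Prop} (of' : ∀ x, p (of x)) (zero : p 0)
    (add : ∀ a b, p a → p b → p (a + b)) (smul : ∀ (t : K) a, p a → p (t • a))
    (mul : ∀ a b, p a → p b → p (a * b)) (a : FreeJordan K X) : p a := by
  -- The elements with property `p` form a subalgebra that contains the generators. Lifting the
  -- generators into it and including back gives the canonical projection, so the subalgebra is
  -- everything.
  let S : NonUnitalSubalgebra K (FreeJordan K X) :=
    { carrier := {a | p a}
      add_mem' := fun {a b} ha hb => add a b ha hb
      zero_mem' := zero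
      mul_mem' := fun {a b} ha hb => mul a b ha hb
      smul_mem' := fun t a ha => smul t a ha }
  let F : FreeNonUnitalNonAssocAlgebra K X →ₙₐ[K] S :=
    FreeNonUnitalNonAssocAlgebra.lift K fun x => ⟨of x, of' x⟩
  have h : (NonUnitalSubalgebraClass.subtype S).comp F = mkHom K X := by
    refine FreeNonUnitalNonAssocAlgebra.hom_ext K fun x => ?_
    have : F (FreeNonUnitalNonAssocAlgebra.of K x) = ⟨of x, of' x⟩ :=
      FreeNonUnitalNonAssocAlgebra.lift_of_apply K _ x
    change (F (FreeNonUnitalNonAssocAlgebra.of K x) : FreeJordan K X) = _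
    rw [this]
    rfl
  obtain ⟨b, rfl⟩ := Quot.exists_rep a
  have hb := DFunLike.congr_fun h b
  change _ = Quot.mk _ b at hb
  rw [← hb]
  exact (F b).2

/-- The universal property of the free Jordan algebra. -/
theorem exists_lift {A : Type*} [NonUnitalNonAssocCommRing A] [Module K A] [IsScalarTower K A A]
    [SMulCommClass K A A] (hJ : ∀ a b : A, (a * a) * (b * a) = ((a * a) * b) * a) (g : X → A) :
    ∃ σ : FreeJordan K X →ₗ[K] A, (∀ x, σ (of x) = g x) ∧ ∀ a b, σ (a * b) = σ a * σ b := by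
  let F : FreeNonUnitalNonAssocAlgebra K X →ₙₐ[K] A := FreeNonUnitalNonAssocAlgebra.lift K g
  have hF : ∀ a b, Rel K X a b → F a = F b := by
    intro a b h
    induction h with
    | comm a b => rw [map_mul, map_mul, mul_comm]
    | jordan a b => simp only [map_mul, hJ]
    | smul t _ ih => rw [map_smul, map_smul, ih]
    | add_right c _ ih => rw [map_add, map_add, ih]
    | mul_left a _ ih => rw [map_mul, map_mul, ih]
    | mul_right c _ ih => rw [map_mul, map_mul, ih]
  refine ⟨{ toFun := Quot.lift F hF, map_add' := ?_, map_smul' := ?_ }, fun x => ?_, ?_⟩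
  · rintro ⟨a⟩ ⟨b⟩; exact map_add F a b
  · rintro t ⟨a⟩; exact map_smul F t a
  · exact FreeNonUnitalNonAssocAlgebra.lift_of_apply K _ x
  · rintro ⟨a⟩ ⟨b⟩; exact map_mul F a b

/-! ### Null extensions of the free Jordan algebra. -/

/-- The underlying space of a null extension of `J` by `M`. -/
def NullExt (J M : Type*) : Type _ := J × M

instance (J M : Type*) [AddCommGroup J] [AddCommGroup M] : AddCommGroup (NullExt J M) :=
  inferInstanceAs (AddCommGroup (J × M))

instance (J M : Type*) [AddCommGroup J] [AddCommGroup M] [Module K J] [Module K M] :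
    Module K (NullExt J M) :=
  inferInstanceAs (Module K (J × M))

/-- A null extension of the free Jordan algebra `J` by `M`, given by a symmetric cochain `φ`, that
satisfies the Jordan identity is split. -/
theorem exists_splitting {M : Type*} [AddCommGroup M] [Module K M]
    (act : FreeJordan K X →ₗ[K] M →ₗ[K] M)
    (φ : FreeJordan K X →ₗ[K] FreeJordan K X →ₗ[K] M) (hφ : ∀ a b, φ a b = φ b a)
    (h1 : ∀ a n, act (a * a) (act a n) = act a (act (a * a) n))
    (h2 : ∀ a b n, act (a * a) (act b n) + (2 : K) • act (a * b) (act a n) =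
      act ((a * a) * b) n + (2 : K) • act a (act b (act a n)))
    (h3 : ∀ a b, act (a * a) (φ a b) + act (a * b) (φ a a) + φ (a * a) (a * b) =
      act a (act b (φ a a)) + act a (φ (a * a) b) + φ ((a * a) * b) a)
    (g : X → M) :
    ∃ β : FreeJordan K X →ₗ[K] M, (∀ x, β (of x) = g x) ∧
      ∀ a b, β (a * b) = act a (β b) + act b (β a) + φ a b := by
  -- The twisted product depends on `act` and `φ`. The type synonym keeps it apart from the
  -- componentwise product on pairs.
  let _ : Mul (NullExt (FreeJordan K X) M) :=
    ⟨fun u v => (u.1 * v.1, act u.1 v.2 + act v.1 u.2 + φ u.1 v.1)⟩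
  have fmul : ∀ u v : NullExt (FreeJordan K X) M, (u * v).1 = u.1 * v.1 := fun _ _ => rfl
  have smul : ∀ u v : NullExt (FreeJordan K X) M,
    (u * v).2 = act u.1 v.2 + act v.1 u.2 + φ u.1 v.1 := fun _ _ => rfl
  have fadd : ∀ u v : NullExt (FreeJordan K X) M, (u + v).1 = u.1 + v.1 := fun _ _ => rfl
  have sadd : ∀ u v : NullExt (FreeJordan K X) M, (u + v).2 = u.2 + v.2 := fun _ _ => rfl
  have fsmul : ∀ (t : K) (u : NullExt (FreeJordan K X) M), (t • u).1 = t • u.1 := fun _ _ => rfl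
  have ssmul : ∀ (t : K) (u : NullExt (FreeJordan K X) M), (t • u).2 = t • u.2 := fun _ _ => rfl
  have fzero : (0 : NullExt (FreeJordan K X) M).1 = 0 := rfl
  have szero : (0 : NullExt (FreeJordan K X) M).2 = 0 := rfl
  let _ : NonUnitalNonAssocCommRing (NullExt (FreeJordan K X) M) :=
    { (inferInstance : AddCommGroup (NullExt (FreeJordan K X) M)),
      (inferInstance : Mul (NullExt (FreeJordan K X) M)) with
      left_distrib := fun u v w => by
        refine Prod.ext ?_ ?_
        · simp only [fmul, fadd, mul_add]
        · simp only [smul, fadd, sadd, map_add, LinearMap.add_apply]; abel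
      right_distrib := fun u v w => by
        refine Prod.ext ?_ ?_
        · simp only [fmul, fadd, add_mul]
        · simp only [smul, fadd, sadd, map_add, LinearMap.add_apply]; abel
      zero_mul := fun u => by
        refine Prod.ext ?_ ?_
        · simp only [fmul, fzero, zero_mul]
        · simp only [smul, fzero, szero, map_zero, LinearMap.zero_apply, add_zero]
      mul_zero := fun u => by
        refine Prod.ext ?_ ?_
        · simp only [fmul, fzero, mul_zero]
        · simp only [smul, fzero, szero, map_zero, LinearMap.zero_apply, add_zero]
      mul_comm := fun u v => by
        refine Prod.ext ?_ ?_
        · simp only [fmul, mul_comm]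
        · simp only [smul, hφ u.1 v.1, add_comm (act u.1 v.2)] }
  have : IsScalarTower K (NullExt (FreeJordan K X) M) (NullExt (FreeJordan K X) M) := ⟨by
    intro t u v
    refine Prod.ext ?_ ?_
    · simp only [smul_eq_mul, fmul, fsmul, smul_mul_assoc]
    · simp only [smul_eq_mul, smul, fsmul, ssmul, map_smul, LinearMap.smul_apply, smul_add]⟩
  have : SMulCommClass K (NullExt (FreeJordan K X) M) (NullExt (FreeJordan K X) M) := ⟨by
    intro t u v
    refine Prod.ext ?_ ?_
    · simp only [smul_eq_mul, fmul, fsmul, mul_smul_comm]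
    · simp only [smul_eq_mul, smul, fsmul, ssmul, map_smul, LinearMap.smul_apply, smul_add]⟩
  obtain ⟨σ, hσ, hσm⟩ := exists_lift (K := K) (X := X) (A := NullExt (FreeJordan K X) M)
    (fun u v => by
      refine Prod.ext ?_ ?_
      · simp only [fmul]
        exact IsJordan.lmul_lmul_comm_rmul _ _
      -- The `M`-component of the Jordan identity is the sum of a part linear in `v.2`, a part
      -- linear in `u.2` and a part in `φ` alone. These are `h1`, `h2` and `h3`.
      · simp only [fmul, smul, map_add]
        have e1 := h1 u.1 v.2
        have e2 := h2 u.1 v.1 u.2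
        have e3 := h3 u.1 v.1
        rw [mul_comm v.1 u.1, hφ v.1 u.1]
        simp only [two_smul] at e2
        linear_combination (norm := abel) e1 + e2 + e3)
    (fun x => (of x, g x))
  -- The homomorphism `σ` is a section of the projection to `J`: their composite is multiplicative
  -- and fixes the generators. The `M`-component of `σ` is therefore the desired `β`.
  have hfst : ∀ a, (σ a).1 = a := by
    intro a
    induction a using induction with
    | of' x => rw [hσ]
    | zero => rw [map_zero]; rfl
    | add a b ha hb => rw [map_add, fadd, ha, hb]
    | smul t a ha => rw [map_smul, fsmul, ha]
    | mul a b ha hb => rw [hσm, fmul, ha, hb]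
  refine ⟨{ toFun := fun a => (σ a).2, map_add' := fun a b => ?_, map_smul' := fun t a => ?_ },
    fun x => ?_, fun a b => ?_⟩
  · rw [map_add, sadd]
  · rw [map_smul, ssmul]; rfl
  · change (σ (of x)).2 = g x
    rw [hσ]
  · change (σ (a * b)).2 = _
    rw [hσm, smul, hfst, hfst]
    rfl

/-! ### The degree grading, and trilinear forms that are cyclic sums. -/

variable [CharZero K]

/-- The Euler derivation of the free Jordan algebra. -/
theorem exists_euler : ∃ E : FreeJordan K X →ₗ[K] FreeJordan K X, (∀ x, E (of x) = of x) ∧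
    ∀ a b, E (a * b) = E a * b + a * E b := by
  -- Derivations of `J` are the splittings of the null extension of `J` by itself with zero cochain.
  obtain ⟨E, h1, h2⟩ := exists_splitting (K := K) (X := X) (LinearMap.mul K (FreeJordan K X)) 0
    (fun _ _ => rfl) (fun a n => by
      simp only [LinearMap.mul_apply']
      exact IsJordan.lmul_lmul_comm_lmul a n)
    (fun a b n => by
      have h := TAG.jordan_linear (K := K) a a n b
      simp only [LinearMap.mul_apply', two_smul]
      simp only [mul_comm] at h ⊢
      linear_combination (norm := abel) -h)
    (fun a b => by simp) of
  refine ⟨E, h1, fun a b => ?_⟩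
  rw [h2]
  simp [mul_comm, add_comm]

/-- The free Jordan algebra is spanned by eigenvectors of the Euler derivation. -/
theorem span_eigenvectors {E : FreeJordan K X →ₗ[K] FreeJordan K X} (h1 : ∀ x, E (of x) = of x)
    (h2 : ∀ a b, E (a * b) = E a * b + a * E b) :
    Submodule.span K {a | ∃ n : ℕ, 0 < n ∧ E a = (n : K) • a} = ⊤ := by
  refine Submodule.eq_top_iff'.2 fun a => ?_
  induction a using induction with
  | of' x => exact Submodule.subset_span ⟨1, one_pos, by rw [h1, Nat.cast_one, one_smul]⟩
  | zero => exact zero_mem _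
  | add a b ha hb => exact add_mem ha hb
  | smul t a ha => exact Submodule.smul_mem _ t ha
  | mul a b ha hb =>
    induction ha, hb using Submodule.span_induction₂ with
    | mem_mem a b ha hb =>
      obtain ⟨i, hi, ha⟩ := ha
      obtain ⟨j, hj, hb⟩ := hb
      refine Submodule.subset_span ⟨i + j, by omega, ?_⟩
      rw [h2, ha, hb, Nat.cast_add, add_smul, smul_mul_assoc, mul_smul_comm]
    | zero_left b hb => rw [zero_mul]; exact zero_mem _
    | zero_right b hb => rw [mul_zero]; exact zero_mem _
    | add_left x y z _ _ _ hx hy => rw [add_mul]; exact add_mem hx hy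
    | add_right x y z _ _ _ hx hy => rw [mul_add]; exact add_mem hx hy
    | smul_left t x y _ _ h => rw [smul_mul_assoc]; exact Submodule.smul_mem _ t h
    | smul_right t x y _ _ h => rw [mul_smul_comm]; exact Submodule.smul_mem _ t h

/-- On the free Jordan algebra, the cyclic cochain given by a symmetric associative form is the
cyclic sum of an alternating form. -/
theorem exists_alternating_of_assoc
    (s : FreeJordan K X →ₗ[K] FreeJordan K X →ₗ[K] K) (hs : ∀ a b, s a b = s b a)
    (hs' : ∀ a b c, s (a * b) c = s a (b * c)) :
    ∃ m : FreeJordan K X →ₗ[K] FreeJordan K X →ₗ[K] K, (∀ a, m a a = 0) ∧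
      ∀ a b c, m (a * b) c + m (b * c) a + m (c * a) b = s (a * b) c := by
  obtain ⟨E, h1, h2⟩ := exists_euler (K := K) (X := X)
  have hspan := span_eigenvectors h1 h2
  set S := {a : FreeJordan K X | ∃ n : ℕ, 0 < n ∧ E a = (n : K) • a} with hS
  have mem : ∀ a, a ∈ Submodule.span K S := fun a => hspan ▸ Submodule.mem_top
  -- On `a ⊗ b` with `a`, `b` homogeneous of degrees `i`, `j`, the map `T` is multiplication by `i +
  -- j > 0`. Its inverse is used to divide `s(a,b)` by the total degree.
  let T : FreeJordan K X ⊗[K] FreeJordan K X →ₗ[K] FreeJordan K X ⊗[K] FreeJordan K X :=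
    LinearMap.rTensor _ E + LinearMap.lTensor _ E
  have hT : ∀ a b, T (a ⊗ₜ b) = E a ⊗ₜ b + a ⊗ₜ E b := fun _ _ => rfl
  have hTtop : ∀ x, x ∈ ⨆ (j : K) (_ : j ≠ 0), Module.End.eigenspace T j := by
    intro x
    induction x with
    | zero => exact zero_mem _
    | add x y hx hy => exact add_mem hx hy
    | tmul a b =>
      induction mem a, mem b using Submodule.span_induction₂ with
      | mem_mem a b ha hb =>
        obtain ⟨i, hi, ha⟩ := ha
        obtain ⟨j, hj, hb⟩ := hb
        have hne : ((i + j : ℕ) : K) ≠ 0 := Nat.cast_ne_zero.2 (by omega)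
        refine Submodule.mem_iSup_of_mem _ (Submodule.mem_iSup_of_mem hne ?_)
        rw [Module.End.mem_eigenspace_iff, hT, ha, hb, Nat.cast_add, add_smul,
          TensorProduct.smul_tmul', TensorProduct.tmul_smul]
      | zero_left b hb => rw [TensorProduct.zero_tmul]; exact zero_mem _
      | zero_right b hb => rw [TensorProduct.tmul_zero]; exact zero_mem _
      | add_left x y z _ _ _ hx hy => rw [TensorProduct.add_tmul]; exact add_mem hx hy
      | add_right x y z _ _ _ hx hy => rw [TensorProduct.tmul_add]; exact add_mem hx hy
      | smul_left t x y _ _ h => rw [← TensorProduct.smul_tmul']; exact Submodule.smul_mem _ t h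
      | smul_right t x y _ _ h => rw [TensorProduct.tmul_smul]; exact Submodule.smul_mem _ t h
  -- The kernel is the eigenspace for 0, which is independent of the sum of the other eigenspaces,
  -- and that sum is the whole space.
  have hker : LinearMap.ker T = ⊥ := by
    refine (Submodule.eq_bot_iff _).2 fun x hx => ?_
    have hd := Module.End.eigenspaces_iSupIndep T (0 : K)
    refine Submodule.disjoint_def.1 hd x ?_ (hTtop x)
    rw [Module.End.mem_eigenspace_iff, zero_smul]
    exact hx
  obtain ⟨T', hT'⟩ := LinearMap.exists_leftInverse_of_injective T hker
  let s' : FreeJordan K X ⊗[K] FreeJordan K X →ₗ[K] K := TensorProduct.lift s ∘ₗ T'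
  have hs'' : ∀ a b, s' (E a ⊗ₜ b) + s' (a ⊗ₜ E b) = s a b := by
    intro a b
    rw [← map_add, ← hT]
    change TensorProduct.lift s ((T' ∘ₗ T) (a ⊗ₜ b)) = _
    rw [hT']
    rfl
  let b' : FreeJordan K X →ₗ[K] FreeJordan K X →ₗ[K] K := (TensorProduct.mk K _ _).compr₂ s'
  -- In degrees `i`, `j` this is `m'(a,b) = (i - j)/(i + j) · s(a,b)`.
  let m' : FreeJordan K X →ₗ[K] FreeJordan K X →ₗ[K] K := b' ∘ₗ E - b'.compl₂ E
  have hm' : ∀ a b, m' a b = s' (E a ⊗ₜ b) - s' (a ⊗ₜ E b) := fun _ _ => rfl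
  have key : ∀ a b c, m' (a * b) c + m' (b * c) a + m' (c * a) b = s (a * b) c := by
    intro a b c
    induction mem c using Submodule.span_induction with
    | zero => simp
    | add x y _ _ hx hy =>
      simp only [mul_add, add_mul, map_add, LinearMap.add_apply]
      linear_combination hx + hy
    | smul t x _ hx =>
      simp only [mul_smul_comm, smul_mul_assoc, map_smul, LinearMap.smul_apply, smul_eq_mul]
      linear_combination t * hx
    | mem c hc =>
    induction mem a, mem b using Submodule.span_induction₂ with
    | mem_mem a b ha hb =>
      obtain ⟨i, hi, ha⟩ := ha
      obtain ⟨j, hj, hb⟩ := hb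
      obtain ⟨k, hk, hc⟩ := hc
      have hne : ((i : K) + j + k) ≠ 0 := by exact_mod_cast (by omega : i + j + k ≠ 0)
      have e1 := hs'' (a * b) c
      have e2 := hs'' (b * c) a
      have e3 := hs'' (c * a) b
      have f2 : s (b * c) a = s (a * b) c := by rw [hs, ← hs']
      have f3 : s (c * a) b = s (a * b) c := by rw [hs', hs]
      simp only [hm']
      simp only [h2, ha, hb, hc, smul_mul_assoc, mul_smul_comm, ← TensorProduct.smul_tmul',
        TensorProduct.tmul_smul, ← add_smul, map_smul, smul_eq_mul, f2, f3] at e1 e2 e3 ⊢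
      -- All three terms involve the same number `s(ab,c)`, and the degree factors add up correctly:
      -- `(i+j-k) + (j+k-i) + (k+i-j) = i+j+k`.
      refine mul_left_cancel₀ hne ?_
      linear_combination (i + j - k : K) * e1 + (j + k - i : K) * e2 + (k + i - j : K) * e3
    | zero_left b hb => simp
    | zero_right b hb => simp
    | add_left x y z _ _ _ hx hy =>
      simp only [mul_add, add_mul, map_add, LinearMap.add_apply]
      linear_combination hx + hy
    | add_right x y z _ _ _ hx hy =>
      simp only [mul_add, add_mul, map_add, LinearMap.add_apply]
      linear_combination hx + hy
    | smul_left t x y _ _ h =>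
      simp only [mul_smul_comm, smul_mul_assoc, map_smul, LinearMap.smul_apply, smul_eq_mul]
      linear_combination t * h
    | smul_right t x y _ _ h =>
      simp only [mul_smul_comm, smul_mul_assoc, map_smul, LinearMap.smul_apply, smul_eq_mul]
      linear_combination t * h
  -- Symmetry of `s'` is what makes `m'` alternating.
  have symm : ∀ a b, s' (a ⊗ₜ b) = s' (b ⊗ₜ a) := by
    intro a b
    induction mem a, mem b using Submodule.span_induction₂ with
    | mem_mem a b ha hb =>
      obtain ⟨i, hi, ha⟩ := ha
      obtain ⟨j, hj, hb⟩ := hb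
      have hne : ((i : K) + j) ≠ 0 := by exact_mod_cast (by omega : i + j ≠ 0)
      have e1 := hs'' a b
      have e2 := hs'' b a
      rw [hs b a] at e2
      simp only [ha, hb, ← TensorProduct.smul_tmul', TensorProduct.tmul_smul, map_smul,
        smul_eq_mul] at e1 e2
      refine mul_left_cancel₀ hne ?_
      linear_combination e1 - e2
    | zero_left b hb => rw [TensorProduct.zero_tmul, TensorProduct.tmul_zero]
    | zero_right b hb => rw [TensorProduct.zero_tmul, TensorProduct.tmul_zero]
    | add_left x y z _ _ _ hx hy =>
      rw [TensorProduct.add_tmul, TensorProduct.tmul_add, map_add, map_add, hx, hy]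
    | add_right x y z _ _ _ hx hy =>
      rw [TensorProduct.add_tmul, TensorProduct.tmul_add, map_add, map_add, hx, hy]
    | smul_left t x y _ _ h =>
      rw [← TensorProduct.smul_tmul', TensorProduct.tmul_smul, map_smul, map_smul, h]
    | smul_right t x y _ _ h =>
      rw [← TensorProduct.smul_tmul', TensorProduct.tmul_smul, map_smul, map_smul, h]
  exact ⟨m', fun a => by rw [hm', symm, sub_self], key⟩

/-- A symmetric trilinear form `φ` on the free Jordan algebra that comes with an alternating
`ψ`, such that the pair satisfies the cocycle conditions, is a cyclic sum of an alternating form. -/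
theorem exists_alternating
    (φ : FreeJordan K X →ₗ[K] FreeJordan K X →ₗ[K] FreeJordan K X →ₗ[K] K)
    (ψ : TAG.B K (FreeJordan K X) →ₗ[K] FreeJordan K X →ₗ[K] FreeJordan K X →ₗ[K] K)
    (hφ : ∀ a b c, φ a b c = φ b a c) (hφ' : ∀ a b c, φ a b c = φ a c b)
    (hψ : ∀ ω a b, ψ ω a b = - ψ ω b a)
    (h1 : ∀ a b c d, ψ (TAG.cls K _ a b) c d + ψ (TAG.cls K _ c d) a b + φ (a * c) b d
      + φ (b * d) a c - φ (a * d) b c - φ (b * c) a d = 0)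
    (h2 : ∀ ω a b c, φ (TAG.toInner K _ ω a) b c + φ a (TAG.toInner K _ ω b) c
      + φ a b (TAG.toInner K _ ω c) = ψ ω (a * b) c + ψ ω (b * c) a + ψ ω (c * a) b) :
    ∃ m : FreeJordan K X →ₗ[K] FreeJordan K X →ₗ[K] K, (∀ a, m a a = 0) ∧
      ∀ a b c, φ a b c = m (a * b) c + m (b * c) a + m (c * a) b := by
  -- The dual `J*` of the regular bimodule: `(a · f)(c) = f(ac)`.
  let act : FreeJordan K X →ₗ[K] Module.Dual K (FreeJordan K X) →ₗ[K]
      Module.Dual K (FreeJordan K X) :=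
    LinearMap.mk₂ K (fun a f => f ∘ₗ LinearMap.mulLeft K a)
      (fun a b f => by ext c; simp [add_mul])
      (fun t a f => by ext c; simp [smul_mul_assoc])
      (fun a f g => rfl) (fun t a f => rfl)
  have hact : ∀ a f c, act a f c = f (a * c) := fun _ _ _ => rfl
  obtain ⟨β, -, hβ⟩ := exists_splitting (K := K) (X := X) act φ
    (fun a b => LinearMap.ext fun c => hφ a b c)
    (fun a f => by
      ext c
      simp only [hact]
      rw [IsJordan.lmul_lmul_comm_lmul])
    (fun a b f => by
      ext c
      have h := congrArg f (TAG.jordan_linear (K := K) a a c b)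
      have h' := congrArg f (TAG.jordan_linear (K := K) a a b c)
      simp only [LinearMap.add_apply, LinearMap.smul_apply, hact, map_add, map_sub, map_zero,
        smul_eq_mul] at h h' ⊢
      simp only [mul_comm] at h h' ⊢
      linear_combination h' - h)
    (fun a b => by
      ext c
      -- Here `ψ` is eliminated. In `e1` the term in `{a ∧ a²}` is zero and `ψ({b ∧ c}; a, a²)`
      -- remains. The identity `e2` expresses three times that value through `φ(∂_{b,c} a, a, a)`.
      have e1 := h1 a (a * a) b c
      have e2 := h2 (TAG.cls K _ b c) a a a
      rw [TAG.cls_sq, map_zero] at e1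
      simp only [LinearMap.add_apply, LinearMap.zero_apply, hact, TAG.toInner_cls,
        TAG.innerDer_apply', map_sub, LinearMap.sub_apply] at e1 e2 ⊢
      rw [hφ (a * b) (a * a), hφ (a * a * c) a, hφ' a (a * a * c), hφ (a * c) (a * a),
        hφ' (a * a) (a * c)] at e1
      rw [hφ (b * (c * a)) a, hφ' a (b * (c * a)), hφ (c * (b * a)) a, hφ' a (c * (b * a)),
        hψ _ (a * a) a] at e2
      rw [mul_comm (a * b) c, mul_comm a b, mul_comm a c]
      rw [mul_comm a b, mul_comm a c] at e1
      have h3 : (3 : K) ≠ 0 := three_ne_zero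
      refine mul_left_cancel₀ h3 ?_
      linear_combination 3 * e1 - e2)
    -- The values of `β` on the generators are arbitrary; zero is as good as any.
    (fun _ => 0)
  have hβ' : ∀ a b c, φ a b c = β (a * b) c - β a (b * c) - β b (a * c) := by
    intro a b c
    have := LinearMap.congr_fun (hβ a b) c
    simp only [LinearMap.add_apply, hact] at this
    linear_combination -this
  have hhalf : (2 : K) * 2⁻¹ = 1 := mul_inv_cancel₀ two_ne_zero
  -- `β = s + m`, with `s` symmetric and `m` alternating.
  let s : FreeJordan K X →ₗ[K] FreeJordan K X →ₗ[K] K := (2⁻¹ : K) • (β + β.flip)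
  let m : FreeJordan K X →ₗ[K] FreeJordan K X →ₗ[K] K := (2⁻¹ : K) • (β - β.flip)
  have hs : ∀ a b, s a b = 2⁻¹ * (β a b + β b a) := fun _ _ => rfl
  have hm : ∀ a b, m a b = 2⁻¹ * (β a b - β b a) := fun _ _ => rfl
  have hsm : ∀ a b c, φ a b c - (m (a * b) c + m (b * c) a + m (c * a) b)
      = s (a * b) c - s a (b * c) - s b (a * c) := by
    intro a b c
    rw [hβ' a b c]
    simp only [hs, hm, mul_comm c a]
    linear_combination (β a (b * c) + β b (a * c) - β (a * b) c) * hhalf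
  -- The left side of `hsm` is invariant under cyclic permutation of `a, b, c`. Comparing the right
  -- sides for `(a,b,c)` and `(b,c,a)` gives `2 s(ab,c) = 2 s(a,bc)`.
  have hassoc : ∀ a b c, s (a * b) c = s a (b * c) := by
    intro a b c
    have e1 := hsm a b c
    have e2 := hsm b c a
    have s1 : ∀ a b, s a b = s b a := fun a b => by rw [hs, hs, add_comm]
    have p : φ b c a = φ a b c := by rw [hφ', hφ]
    rw [p, s1 b (c * a), s1 c, mul_comm b a] at e2
    rw [s1 b, s1 a, mul_comm a c] at e1
    have h2 : (2 : K) ≠ 0 := two_ne_zero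
    refine mul_left_cancel₀ h2 ?_
    rw [s1 a]
    linear_combination e2 - e1
  obtain ⟨m', hm', hm''⟩ := exists_alternating_of_assoc s
    (fun a b => by rw [hs, hs, add_comm]) hassoc
  -- By associativity the right side of `hsm` collapses to `-s(ab,c)`, the negative of the cyclic
  -- sum of `m'`.
  refine ⟨m - m', fun a => by simp [hm, hm'], fun a b c => ?_⟩
  have e1 := hsm a b c
  have e2 := hm'' a b c
  have e3 := hassoc a b c
  have e4 := hassoc b a c
  rw [mul_comm b a] at e4
  simp only [LinearMap.sub_apply]
  linear_combination e1 + e2 + e3 + e4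

end FreeJordan

/-! ### Invariant multilinear forms on `sl₂`. -/

namespace TAG

section sl2
variable (K : Type*) [Field K]

/-- The raising element of `sl₂`. -/
def sl2E : sl2 K := (sl2Equiv K).symm ![1, 0, 0]
/-- The lowering element of `sl₂`. -/
def sl2F : sl2 K := (sl2Equiv K).symm ![0, 1, 0]
/-- The semisimple element of `sl₂`. -/
def sl2H : sl2 K := (sl2Equiv K).symm ![0, 0, 1]

theorem sl2E_val : (sl2E K).1 = !![0, 1; 0, 0] := by
  change !![(0 : K), 1; 0, -0] = _
  rw [neg_zero]
theorem sl2F_val : (sl2F K).1 = !![0, 0; 1, 0] := by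
  change !![(0 : K), 0; 1, -0] = _
  rw [neg_zero]
theorem sl2H_val : (sl2H K).1 = !![1, 0; 0, -1] := rfl

theorem lie_E_F : ⁅sl2E K, sl2F K⁆ = sl2H K := by
  apply Subtype.ext
  rw [LieAlgebra.SpecialLinear.sl_bracket, sl2E_val, sl2F_val, sl2H_val]
  ext i j
  fin_cases i <;> fin_cases j <;> simp

theorem lie_H_E : ⁅sl2H K, sl2E K⁆ = (2 : K) • sl2E K := by
  apply Subtype.ext
  change (⁅sl2H K, sl2E K⁆ : sl2 K).1 = (2 : K) • (sl2E K).1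
  rw [LieAlgebra.SpecialLinear.sl_bracket, sl2E_val, sl2H_val]
  ext i j
  fin_cases i <;> fin_cases j <;> simp
  norm_num

theorem lie_H_F : ⁅sl2H K, sl2F K⁆ = (-2 : K) • sl2F K := by
  apply Subtype.ext
  change (⁅sl2H K, sl2F K⁆ : sl2 K).1 = (-2 : K) • (sl2F K).1
  rw [LieAlgebra.SpecialLinear.sl_bracket, sl2F_val, sl2H_val]
  ext i j
  fin_cases i <;> fin_cases j <;> simp
  norm_num

theorem lie_F_E : ⁅sl2F K, sl2E K⁆ = - sl2H K := by rw [← lie_skew, lie_E_F]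

theorem lie_E_H : ⁅sl2E K, sl2H K⁆ = (-2 : K) • sl2E K := by rw [← lie_skew, lie_H_E, neg_smul]

theorem lie_F_H : ⁅sl2F K, sl2H K⁆ = (2 : K) • sl2F K := by
  rw [← lie_skew, lie_H_F, neg_smul, neg_neg]

variable {K}

theorem sl2_decomp (x : sl2 K) :
    x = x.1 0 1 • sl2E K + x.1 1 0 • sl2F K + x.1 0 0 • sl2H K := by
  apply (sl2Equiv K).injective
  simp only [map_add, map_smul, sl2E, sl2F, sl2H, LinearEquiv.apply_symm_apply]
  ext i
  fin_cases i <;> simp [sl2Equiv]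

theorem sl2_linear_ext {N : Type*} [AddCommMonoid N] [Module K N] {f g : sl2 K →ₗ[K] N}
    (hE : f (sl2E K) = g (sl2E K)) (hF : f (sl2F K) = g (sl2F K))
    (hH : f (sl2H K) = g (sl2H K)) : f = g := by
  ext x
  rw [sl2_decomp x]
  simp only [map_add, map_smul, hE, hF, hH]

variable [CharZero K]

theorem kappa_E_F : kappa K (sl2E K) (sl2F K) = 2 := by
  simp [kappa_apply, sl2E_val, sl2F_val, Matrix.trace_fin_two]
theorem kappa_E_H : kappa K (sl2E K) (sl2H K) = 0 := by
  simp [kappa_apply, sl2E_val, sl2H_val, Matrix.trace_fin_two]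
theorem kappa_F_H : kappa K (sl2F K) (sl2H K) = 0 := by
  simp [kappa_apply, sl2F_val, sl2H_val, Matrix.trace_fin_two]
theorem kappa_H_H : kappa K (sl2H K) (sl2H K) = 4 := by
  simp [kappa_apply, sl2H_val, Matrix.trace_fin_two]
  norm_num

theorem kappa_F_E : kappa K (sl2F K) (sl2E K) = 2 := by rw [kappa_symm, kappa_E_F]

/-- An invariant linear form on `sl₂` vanishes. -/
theorem invariant_linear (T : sl2 K →ₗ[K] K) (hT : ∀ s x : sl2 K, T ⁅s, x⁆ = 0) : T = 0 := by
  have h2 : (2 : K) ≠ 0 := two_ne_zero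
  -- `sl₂` is perfect: up to nonzero scalars, each basis vector is a bracket.
  have hE := hT (sl2H K) (sl2E K)
  have hF := hT (sl2H K) (sl2F K)
  have hH := hT (sl2E K) (sl2F K)
  rw [lie_H_E, map_smul, smul_eq_zero] at hE
  rw [lie_H_F, map_smul, smul_eq_zero] at hF
  rw [lie_E_F] at hH
  exact sl2_linear_ext (hE.resolve_left h2) (hF.resolve_left (neg_ne_zero.2 h2)) hH

/-- An invariant bilinear form on `sl₂` is a multiple of `κ`. -/
theorem invariant_bilinear (T : sl2 K →ₗ[K] sl2 K →ₗ[K] K)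
    (hT : ∀ s x y : sl2 K, T ⁅s, x⁆ y + T x ⁅s, y⁆ = 0) (x y : sl2 K) :
    T x y = kappa K x y * (4⁻¹ * T (sl2H K) (sl2H K)) := by
  -- Invariance, used twice, moves `[s,[u,·]]` across the form: `T([s,[u,v]], y) = T(v, [u,[s,y]])`.
  -- The formula for double brackets in terms of `κ` then leaves this identity.
  have key : ∀ s u v y, kappa K s v * T u y = kappa K u y * T v s := by
    intro s u v y
    have h1 := hT s ⁅u, v⁆ y
    have h2 := hT u v ⁅s, y⁆
    rw [lie_lie_sl2] at h1 h2
    simp only [map_sub, map_smul, LinearMap.sub_apply, LinearMap.smul_apply, smul_eq_mul] at h1 h2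
    rw [kappa_symm u s] at h2
    linear_combination -h1 + h2
  -- With `s = v = h` the left factor is `κ(h,h) = 4`.
  have h := key (sl2H K) x (sl2H K) y
  rw [kappa_H_H] at h
  have h4 : (4 : K) * 4⁻¹ = 1 := mul_inv_cancel₀ (by norm_num)
  linear_combination 4⁻¹ * h - T x y * h4

/-- An invariant trilinear form on `sl₂` vanishes if it does so on the basis. -/
theorem invariant_trilinear_eq_zero (T : sl2 K →ₗ[K] sl2 K →ₗ[K] sl2 K →ₗ[K] K)
    (hT : ∀ s x y z : sl2 K, T ⁅s, x⁆ y z + T x ⁅s, y⁆ z + T x y ⁅s, z⁆ = 0)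
    (h0 : T (sl2E K) (sl2F K) (sl2H K) = 0) : T = 0 := by
  have hEF := lie_E_F K
  have hHE := lie_H_E K
  have hHF := lie_H_F K
  have hFE := lie_F_E K
  have hEH := lie_E_H K
  set e := sl2E K
  set f := sl2F K
  set h := sl2H K
  -- Only arguments of total weight zero matter: the permutations of `e, f, h`, and `h, h, h`.
  -- Invariance under `e` and `f` ties these values to `T(e,f,h)`.
  have v1 := hT e e f f
  have v2 := hT e f e f
  have w1 := hT f f e e
  have w2 := hT f e f e
  have w3 := hT f e e f
  have v4 := hT e f h h
  simp only [hEF, hFE, hEH, lie_self, map_neg, map_smul, map_zero, LinearMap.neg_apply,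
    LinearMap.smul_apply, LinearMap.zero_apply, smul_eq_mul, h0] at v1 v2 v4 w1 w2 w3
  have ehf : T e h f = 0 := by linear_combination v1
  have hef : T h e f = 0 := by linear_combination -w3 - ehf
  have feh : T f e h = 0 := by linear_combination v2 - hef
  have fhe : T f h e = 0 := by linear_combination -w1 - feh
  have hfe : T h f e = 0 := by linear_combination -w2
  have hhh : T h h h = 0 := by linear_combination v4 + 2 * feh + 2 * fhe
  have hHH : ⁅h, h⁆ = (0 : K) • h := by rw [lie_self, zero_smul]
  -- Invariance under `h` kills the values at arguments of nonzero total weight.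
  have wt : ∀ {x y z : sl2 K} {i j k : K}, ⁅h, x⁆ = i • x → ⁅h, y⁆ = j • y → ⁅h, z⁆ = k • z →
      i + j + k ≠ 0 → T x y z = 0 := by
    intro x y z i j k hx hy hz hne
    have H := hT h x y z
    simp only [hx, hy, hz, map_smul, LinearMap.smul_apply, smul_eq_mul] at H
    refine (mul_eq_zero.1 ?_).resolve_left hne
    linear_combination H
  refine sl2_linear_ext ?_ ?_ ?_ <;> refine sl2_linear_ext ?_ ?_ ?_ <;>
    refine sl2_linear_ext ?_ ?_ ?_ <;>
    first
    | exact h0 | exact ehf | exact hef | exact feh | exact fhe | exact hfe | exact hhh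
    | exact wt (by first | exact hHE | exact hHF | exact hHH)
        (by first | exact hHE | exact hHF | exact hHH)
        (by first | exact hHE | exact hHF | exact hHH) (by norm_num)

/-- An invariant trilinear form on `sl₂` is a multiple of `κ([x, y], z)`. -/
theorem invariant_trilinear (T : sl2 K →ₗ[K] sl2 K →ₗ[K] sl2 K →ₗ[K] K)
    (hT : ∀ s x y z : sl2 K, T ⁅s, x⁆ y z + T x ⁅s, y⁆ z + T x y ⁅s, z⁆ = 0) (x y z : sl2 K) :
    T x y z = kappa K ⁅x, y⁆ z * (4⁻¹ * T (sl2E K) (sl2F K) (sl2H K)) := by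
  -- Scaled so that `S` and `T` agree at `(e,f,h)`, where `κ([e,f],h) = 4`.
  let S : sl2 K →ₗ[K] sl2 K →ₗ[K] sl2 K →ₗ[K] K := (4⁻¹ * T (sl2E K) (sl2F K) (sl2H K)) •
    ((LieModule.toEnd K (sl2 K) (sl2 K) : sl2 K →ₗ[K] sl2 K →ₗ[K] sl2 K).compr₂ (kappa K))
  have hS : ∀ x y z, S x y z = kappa K ⁅x, y⁆ z * (4⁻¹ * T (sl2E K) (sl2F K) (sl2H K)) :=
    fun x y z => mul_comm _ _
  have h4 : (4 : K) * 4⁻¹ = 1 := mul_inv_cancel₀ (by norm_num)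
  have h := invariant_trilinear_eq_zero (T + (-1 : K) • S) (fun s x y z => by
    have h1 := hT s x y z
    have h2 : kappa K ⁅x, y⁆ ⁅s, z⁆ = - kappa K ⁅s, ⁅x, y⁆⁆ z := by
      rw [kappa_lie, ← lie_skew, map_neg, LinearMap.neg_apply]
    have h3 : ⁅s, ⁅x, y⁆⁆ = ⁅⁅s, x⁆, y⁆ + ⁅x, ⁅s, y⁆⁆ := leibniz_lie s x y
    rw [h3, map_add, LinearMap.add_apply] at h2
    simp only [LinearMap.add_apply, LinearMap.smul_apply, smul_eq_mul, hS, h2]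
    linear_combination h1) (by
    simp only [LinearMap.add_apply, LinearMap.smul_apply, smul_eq_mul, hS, lie_E_F, kappa_H_H]
    linear_combination - T (sl2E K) (sl2F K) (sl2H K) * h4)
  have h' := LinearMap.congr_fun (LinearMap.congr_fun (LinearMap.congr_fun h x) y) z
  simp only [LinearMap.add_apply, LinearMap.smul_apply, smul_eq_mul, hS,
    LinearMap.zero_apply] at h'
  linear_combination h'

end sl2
end TAG

/-! ### Invariant 3-cocycles of `TAG(J)` and their primitives. -/

namespace TAG

variable {K J : Type*} [Field K] [CharZero K] [NonUnitalNonAssocCommRing J] [Module K J]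
  [IsScalarTower K J J] [SMulCommClass K J J] [IsCommJordan J]

variable (K J) in
/-- The inclusion of `BJ` in `TAG(J)`. -/
def inB : B K J →ₗ[K] TAG K J where
  toFun ω := ⟨ω, 0⟩
  map_add' _ _ := by ext <;> simp
  map_smul' _ _ := by ext <;> simp

variable (K J) in
/-- The element `x(a)` of `TAG(J)`, as a bilinear map. -/
def inS : sl2 K →ₗ[K] J →ₗ[K] TAG K J :=
  (TensorProduct.mk K (sl2 K) J).compr₂
    { toFun := fun s => ⟨0, s⟩
      map_add' := fun _ _ => by ext <;> simp
      map_smul' := fun _ _ => by ext <;> simp }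

theorem inB_def (ω : B K J) : inB K J ω = ⟨ω, 0⟩ := rfl
theorem inS_def (x : sl2 K) (a : J) : inS K J x a = ⟨0, x ⊗ₜ a⟩ := rfl

theorem lie_inS_inS (x y : sl2 K) (a b : J) :
    ⁅inS K J x a, inS K J y b⁆ =
      inS K J ⁅x, y⁆ (a * b) + kappa K x y • inB K J (cls K J a b) := by
  ext <;> simp [inS_def, inB_def]

theorem lie_inB_inS (ω : B K J) (x : sl2 K) (a : J) :
    ⁅inB K J ω, inS K J x a⁆ = inS K J x (toInner K J ω a) := by
  ext <;> simp [inS_def, inB_def]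

theorem lie_inB_inB (ω ω' : B K J) :
    ⁅inB K J ω, inB K J ω'⁆ = inB K J (bracketB K J ω ω') := by
  ext <;> simp [inB_def]

theorem sl2Action_inS (s x : sl2 K) (a : J) :
    sl2Action K J s (inS K J x a) = inS K J ⁅s, x⁆ a := rfl

theorem sl2Action_inB (s : sl2 K) (ω : B K J) : sl2Action K J s (inB K J ω) = 0 := by
  change (⟨0, adS K J s 0⟩ : TAG K J) = 0
  rw [map_zero]
  rfl

theorem induction {p : TAG K J → Prop} (hB : ∀ ω, p (inB K J ω)) (hS : ∀ x a, p (inS K J x a))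
    (add : ∀ u v, p u → p v → p (u + v)) (u : TAG K J) : p u := by
  obtain ⟨ω, s⟩ := u
  have h : (⟨ω, s⟩ : TAG K J) = inB K J ω + ⟨0, s⟩ := by ext <;> simp [inB_def]
  rw [h]
  refine add _ _ (hB ω) ?_
  clear h
  induction s with
  | zero => exact hB 0
  | tmul x a => exact hS x a
  | add s t hs ht =>
    have h : (⟨0, s + t⟩ : TAG K J) = ⟨0, s⟩ + ⟨0, t⟩ := by ext <;> simp
    rw [h]
    exact add _ _ hs ht

/-- The trilinear map `(a, b, c) ↦ T (i a) (j b) (k c)`. -/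
def pull {L A B C : Type*} [AddCommGroup L] [Module K L] [AddCommGroup A] [Module K A]
    [AddCommGroup B] [Module K B] [AddCommGroup C] [Module K C]
    (T : L →ₗ[K] L →ₗ[K] L →ₗ[K] K) (i : A →ₗ[K] L) (j : B →ₗ[K] L) (k : C →ₗ[K] L) :
    A →ₗ[K] B →ₗ[K] C →ₗ[K] K :=
  (T.compl₁₂ i j).compr₂ (LinearMap.lcomp K K k)

variable (K J) in
/-- An `sl₂`-invariant alternating `3`-cocycle of `TAG(J)`. -/
structure InvCocycle (c : TAG K J →ₗ[K] TAG K J →ₗ[K] TAG K J →ₗ[K] K) : Prop where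
  swap₁ : ∀ u v w, c u v w = - c v u w
  swap₂ : ∀ u v w, c u v w = - c u w v
  inv : ∀ (s : sl2 K) u v w, c (sl2Action K J s u) v w + c u (sl2Action K J s v) w
    + c u v (sl2Action K J s w) = 0
  cocycle : ∀ x y z t, c ⁅x, y⁆ z t + c y ⁅x, z⁆ t + c y z ⁅x, t⁆ - c x ⁅y, z⁆ t + c x ⁅y, t⁆ z
    - c x ⁅z, t⁆ y = 0

variable (c : TAG K J →ₗ[K] TAG K J →ₗ[K] TAG K J →ₗ[K] K)

/-- The trilinear form on `J` that describes the restriction of an invariant `3`-cochain to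
`sl₂ ⊗ J`. -/
def cochainS : J →ₗ[K] J →ₗ[K] J →ₗ[K] K :=
  -- The factor cancels `κ([e,f],h) = 4`.
  (4⁻¹ : K) • pull c (inS K J (sl2E K)) (inS K J (sl2F K)) (inS K J (sl2H K))

/-- The form on `BJ × J × J` that describes the restriction of an invariant `3`-cochain to
`BJ ⊗ Λ²(sl₂ ⊗ J)`. -/
def cochainB : B K J →ₗ[K] J →ₗ[K] J →ₗ[K] K :=
  -- The factor cancels `κ(h,h) = 4`.
  (4⁻¹ : K) • pull c (inB K J) (inS K J (sl2H K)) (inS K J (sl2H K))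

namespace InvCocycle

variable {c} (hc : InvCocycle K J c)
include hc

/-- For fixed `a, b, d` the left side is an invariant trilinear form on `sl₂`, hence a multiple of
`κ([x,y],z)`. -/
theorem apply_SSS (x y z : sl2 K) (a b d : J) :
    c (inS K J x a) (inS K J y b) (inS K J z d) = kappa K ⁅x, y⁆ z * cochainS c a b d :=
  invariant_trilinear (pull c ((inS K J).flip a) ((inS K J).flip b) ((inS K J).flip d))
    (fun s x y z => hc.inv s (inS K J x a) (inS K J y b) (inS K J z d)) x y z

theorem apply_BSS (ω : B K J) (x y : sl2 K) (a b : J) :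
    c (inB K J ω) (inS K J x a) (inS K J y b) = kappa K x y * cochainB c ω a b :=
  invariant_bilinear ((c (inB K J ω)).compl₁₂ ((inS K J).flip a) ((inS K J).flip b))
    (fun s x y => by
      have h := hc.inv s (inB K J ω) (inS K J x a) (inS K J y b)
      rwa [sl2Action_inB, map_zero, LinearMap.zero_apply, LinearMap.zero_apply, zero_add] at h) x y

/-- `sl₂` acts trivially on `BJ`, so this is an invariant linear form in `x`, and `sl₂` has none but
zero. -/
theorem apply_BBS (ω ω' : B K J) (x : sl2 K) (a : J) :
    c (inB K J ω) (inB K J ω') (inS K J x a) = 0 :=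
  LinearMap.congr_fun (invariant_linear (c (inB K J ω) (inB K J ω') ∘ₗ (inS K J).flip a)
    (fun s x => by
      have h := hc.inv s (inB K J ω) (inB K J ω') (inS K J x a)
      rwa [sl2Action_inB, sl2Action_inB, map_zero, map_zero, LinearMap.zero_apply,
        LinearMap.zero_apply, zero_add, zero_add] at h)) x

/-- Both `c` and `κ([x,y],z)` change sign under exchange of arguments, so the remaining factor is
symmetric. -/
theorem cochainS_swap₁ (a b d : J) : cochainS c a b d = cochainS c b a d := by
  have h := hc.swap₁ (inS K J (sl2E K) a) (inS K J (sl2F K) b) (inS K J (sl2H K) d)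
  rw [hc.apply_SSS, hc.apply_SSS, lie_E_F, lie_F_E, map_neg, LinearMap.neg_apply,
    kappa_H_H] at h
  refine mul_left_cancel₀ (by norm_num : (4 : K) ≠ 0) ?_
  linear_combination h

theorem cochainS_swap₂ (a b d : J) : cochainS c a b d = cochainS c a d b := by
  have h := hc.swap₂ (inS K J (sl2E K) a) (inS K J (sl2F K) b) (inS K J (sl2H K) d)
  have h' : kappa K ⁅sl2E K, sl2H K⁆ (sl2F K) = -4 := by
    rw [lie_E_H, map_smul, LinearMap.smul_apply, kappa_E_F, smul_eq_mul]
    norm_num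
  rw [hc.apply_SSS, hc.apply_SSS, lie_E_F, kappa_H_H, h'] at h
  refine mul_left_cancel₀ (by norm_num : (4 : K) ≠ 0) ?_
  linear_combination h

/-- `c` is alternating and `κ` symmetric, so the remaining factor is skew. -/
theorem cochainB_skew (ω : B K J) (a b : J) : cochainB c ω a b = - cochainB c ω b a := by
  have h := hc.swap₂ (inB K J ω) (inS K J (sl2H K) a) (inS K J (sl2H K) b)
  rw [hc.apply_BSS, hc.apply_BSS, kappa_H_H] at h
  refine mul_left_cancel₀ (by norm_num : (4 : K) ≠ 0) ?_
  linear_combination h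

theorem apply_SSB (ω : B K J) (x y : sl2 K) (a b : J) :
    c (inS K J x a) (inS K J y b) (inB K J ω) = kappa K x y * cochainB c ω a b := by
  rw [hc.swap₂, hc.swap₁, neg_neg, hc.apply_BSS]

theorem apply_SBS (ω : B K J) (x y : sl2 K) (a b : J) :
    c (inS K J x a) (inB K J ω) (inS K J y b) = - (kappa K x y * cochainB c ω a b) := by
  rw [hc.swap₁, hc.apply_BSS]

/-- The cocycle condition on `Λ⁴(sl₂ ⊗ J)`. -/
theorem cocycle_SSSS (a b d d' : J) :
    cochainB c (cls K J a b) d d' + cochainB c (cls K J d d') a b + cochainS c (a * d) b d'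
      + cochainS c (b * d') a d - cochainS c (a * d') b d - cochainS c (b * d) a d' = 0 := by
  -- At `e, f, h, h` both `ψ`-terms carry the factor `κ(e,f) κ(h,h) = 8`, which is divided out at
  -- the end.
  have h := hc.cocycle (inS K J (sl2E K) a) (inS K J (sl2F K) b) (inS K J (sl2H K) d)
    (inS K J (sl2H K) d')
  simp only [lie_inS_inS, map_add, map_smul, LinearMap.add_apply, LinearMap.smul_apply,
    smul_eq_mul, hc.apply_SSS, hc.apply_BSS, hc.apply_SBS, hc.apply_SSB, lie_E_F, lie_E_H, lie_F_E,
    lie_F_H, lie_self, map_zero, map_neg, LinearMap.neg_apply, LinearMap.zero_apply, kappa_H_H, kappa_E_F, kappa_F_E,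
    kappa_E_H, kappa_F_H] at h
  rw [hc.cochainS_swap₂ b d, hc.cochainS_swap₁ b (a * d'), hc.cochainS_swap₁ a (b * d),
    hc.cochainS_swap₁ a (b * d'), hc.cochainS_swap₁ b (a * d)] at h
  linear_combination 8⁻¹ * h

/-- The cocycle condition on `BJ ⊗ Λ³(sl₂ ⊗ J)`. -/
theorem cocycle_BSSS (ω : B K J) (a b d : J) :
    cochainS c (toInner K J ω a) b d + cochainS c a (toInner K J ω b) d
      + cochainS c a b (toInner K J ω d) =
    cochainB c ω (a * b) d + cochainB c ω (b * d) a + cochainB c ω (d * a) b := by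
  have h := hc.cocycle (inB K J ω) (inS K J (sl2E K) a) (inS K J (sl2F K) b) (inS K J (sl2H K) d)
  simp only [lie_inS_inS, lie_inB_inS, map_add, map_smul, LinearMap.add_apply,
    LinearMap.smul_apply, smul_eq_mul, hc.apply_SSS, hc.apply_BSS, hc.apply_BBS, lie_E_F, lie_E_H,
    lie_F_H, kappa_H_H, kappa_E_F, kappa_F_E, kappa_E_H, kappa_F_H] at h
  rw [mul_comm d a]
  linear_combination 4⁻¹ * h

/-- The cocycle condition on `Λ²BJ ⊗ Λ²(sl₂ ⊗ J)`. -/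
theorem cocycle_BBSS (ω ω' : B K J) (a b : J) :
    cochainB c (bracketB K J ω ω') a b + cochainB c ω' (toInner K J ω a) b
      + cochainB c ω' a (toInner K J ω b) - cochainB c ω (toInner K J ω' a) b
      - cochainB c ω a (toInner K J ω' b)
      + c (inB K J (cls K J a b)) (inB K J ω) (inB K J ω') = 0 := by
  have h := hc.cocycle (inB K J ω) (inB K J ω') (inS K J (sl2H K) a) (inS K J (sl2H K) b)
  simp only [lie_inS_inS, lie_inB_inS, lie_inB_inB, map_add, map_smul, LinearMap.add_apply,
    LinearMap.smul_apply, lie_self, map_zero, LinearMap.zero_apply, kappa_H_H,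
    smul_eq_mul, hc.apply_BSS] at h
  rw [hc.swap₁ (inB K J ω), hc.cochainB_skew ω _ a] at h
  linear_combination 4⁻¹ * h

/-- An invariant `3`-cocycle of `TAG(J)` is a coboundary if its restriction to `sl₂ ⊗ J` is given
by the cyclic sum of an alternating form. -/
theorem exists_primitive (m : J →ₗ[K] J →ₗ[K] K) (hm : ∀ a, m a a = 0)
    (hm' : ∀ a b d, cochainS c a b d = m (a * b) d + m (b * d) a + m (d * a) b) :
    ∃ μ : TAG K J →ₗ[K] TAG K J →ₗ[K] K, (∀ u, μ u u = 0) ∧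
      ∀ u v w, c u v w = μ ⁅u, v⁆ w - μ ⁅u, w⁆ v + μ ⁅v, w⁆ u := by
  have skew : ∀ a b, m a b = - m b a := by
    intro a b
    have h := hm (a + b)
    simp only [map_add, LinearMap.add_apply, hm, zero_add, add_zero] at h
    linear_combination h
  have hψ0 : ∀ ω a, cochainB c ω a a = 0 := fun ω a =>
    eq_zero_of_eq_neg (K := K) (hc.cochainB_skew ω a a)
  -- The value of `n({a ∧ b}, ω)` is forced by `c = dμ` on `BJ ⊗ Λ²(sl₂ ⊗ J)`, once `μ` is `κ ⊗ m`
  -- on `sl₂ ⊗ J` and zero on mixed pairs.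
  let g : J →ₗ[K] J →ₗ[K] B K J →ₗ[K] K := LinearMap.mk₂ K
    (fun a b =>
      { toFun := fun ω => cochainB c ω a b - m (toInner K J ω a) b - m a (toInner K J ω b)
        map_add' := fun _ _ => by simp only [map_add, LinearMap.add_apply]; ring
        map_smul' := fun _ _ => by
          simp only [map_smul, LinearMap.smul_apply, smul_eq_mul, RingHom.id_apply]; ring })
    (fun _ _ _ => LinearMap.ext fun _ => by
      simp only [LinearMap.coe_mk, AddHom.coe_mk, map_add, LinearMap.add_apply]; ring)
    (fun _ _ _ => LinearMap.ext fun _ => by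
      simp only [LinearMap.coe_mk, AddHom.coe_mk, map_smul, LinearMap.smul_apply, smul_eq_mul]
      ring)
    (fun _ _ _ => LinearMap.ext fun _ => by
      simp only [LinearMap.coe_mk, AddHom.coe_mk, map_add, LinearMap.add_apply]; ring)
    (fun _ _ _ => LinearMap.ext fun _ => by
      simp only [LinearMap.coe_mk, AddHom.coe_mk, map_smul, LinearMap.smul_apply, smul_eq_mul]
      ring)
  have hg : ∀ a b ω, g a b ω = cochainB c ω a b - m (toInner K J ω a) b - m a (toInner K J ω b) :=
    fun _ _ _ => rfl
  let n : B K J →ₗ[K] B K J →ₗ[K] K := liftB g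
    (fun a => LinearMap.ext fun ω => by
      rw [hg, hψ0, skew a]
      simp)
    (fun a => LinearMap.ext fun ω => by
      -- The relation `g(a, a²) = 0`, needed to descend to `BJ`, is the diagonal case of the
      -- condition on `BJ ⊗ Λ³(sl₂ ⊗ J)`.
      have h := hc.cocycle_BSSS ω a a a
      simp only [hm'] at h
      rw [hg, toInner_mul, map_add]
      rw [mul_comm a (toInner K J ω a)] at h ⊢
      rw [hc.cochainB_skew] at h
      rw [skew a, skew _ (a * a), LinearMap.zero_apply]
      linear_combination 3⁻¹ * h)
  have hn : ∀ a b ω, n (cls K J a b) ω = g a b ω := fun a b ω => by rw [liftB_cls]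
  -- Skewness of `n` is the cocycle condition on `Λ⁴(sl₂ ⊗ J)`, after `φ` is replaced by the cyclic
  -- sum of `m`.
  have hn' : ∀ ω ω', n ω ω' = - n ω' ω := by
    intro ω ω'
    induction ω using cls_induction with
    | add x y hx hy => simp only [map_add, LinearMap.add_apply, hx, hy]; ring
    | smul t x hx => simp only [map_smul, LinearMap.smul_apply, hx, smul_neg]
    | cls' a b =>
      induction ω' using cls_induction with
      | add x y hx hy => simp only [map_add, LinearMap.add_apply, hx, hy]; ring
      | smul t x hx => simp only [map_smul, LinearMap.smul_apply, hx, smul_neg]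
      | cls' d d' =>
        have h := hc.cocycle_SSSS a b d d'
        simp only [hn, hg, toInner_cls, innerDer_apply', hm', map_sub, LinearMap.sub_apply] at h ⊢
        have k₁ := skew (b * d') (a * d)
        have k₂ := skew (b * d) (a * d')
        have k₃ := skew a (d * (d' * b))
        have k₄ := skew a (d' * (d * b))
        have k₅ := skew d (a * (b * d'))
        have k₆ := skew d (b * (a * d'))
        simp only [mul_comm] at h k₁ k₂ k₃ k₄ k₅ k₆ ⊢
        linear_combination h - k₁ + k₂ - k₃ + k₄ - k₅ + k₆
  -- For `ω₁ = {a ∧ b}`, the condition on `Λ²BJ ⊗ Λ²(sl₂ ⊗ J)` expresses the restriction of `c` to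
  -- `BJ` through `ψ`.
  have hχ : ∀ ω₁ ω₂ ω₃, c (inB K J ω₁) (inB K J ω₂) (inB K J ω₃) =
      n (bracketB K J ω₁ ω₂) ω₃ - n (bracketB K J ω₁ ω₃) ω₂ + n (bracketB K J ω₂ ω₃) ω₁ := by
    intro ω₁ ω₂ ω₃
    induction ω₁ using cls_induction with
    | add x y hx hy => simp only [map_add, LinearMap.add_apply, hx, hy]; ring
    | smul t x hx => simp only [map_smul, LinearMap.smul_apply, hx, smul_eq_mul]; ring
    | cls' a b =>
      have h := hc.cocycle_BBSS ω₂ ω₃ a b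
      rw [hn' (bracketB K J ω₂ ω₃), bracketB_skew _ ω₂, bracketB_skew _ ω₃]
      simp only [bracketB_cls, map_neg, map_add, LinearMap.neg_apply, LinearMap.add_apply, hn, hg,
        toInner_bracketB, map_sub, LinearMap.sub_apply]
      linear_combination h
  let μS : (sl2 K ⊗[K] J) →ₗ[K] (sl2 K ⊗[K] J) →ₗ[K] K :=
    (TensorProduct.map₂ (kappa K) m).compr₂ (TensorProduct.lid K K).toLinearMap
  have hμS : ∀ x y a b, μS (x ⊗ₜ a) (y ⊗ₜ b) = kappa K x y * m a b := fun _ _ _ _ => rfl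
  let μ : TAG K J →ₗ[K] TAG K J →ₗ[K] K := LinearMap.mk₂ K (fun u v => n u.1 v.1 + μS u.2 v.2)
    (fun _ _ _ => by simp only [add_fst, add_snd, map_add, LinearMap.add_apply]; ring)
    (fun _ _ _ => by
      simp only [smul_fst, smul_snd, map_smul, LinearMap.smul_apply, smul_eq_mul]; ring)
    (fun _ _ _ => by simp only [add_fst, add_snd, map_add]; ring)
    (fun _ _ _ => by simp only [smul_fst, smul_snd, map_smul, smul_eq_mul]; ring)
  have hBB : ∀ ω ω', μ (inB K J ω) (inB K J ω') = n ω ω' := fun ω ω' => by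
    change n ω ω' + μS 0 0 = _
    rw [map_zero, add_zero]
  have hBS : ∀ ω x a, μ (inB K J ω) (inS K J x a) = 0 := fun ω x a => by
    change n ω 0 + μS 0 _ = _
    rw [map_zero, map_zero, LinearMap.zero_apply, add_zero]
  have hSB : ∀ ω x a, μ (inS K J x a) (inB K J ω) = 0 := fun ω x a => by
    change n 0 ω + μS _ 0 = _
    rw [map_zero, map_zero, LinearMap.zero_apply, add_zero]
  have hSS : ∀ x y a b, μ (inS K J x a) (inS K J y b) = kappa K x y * m a b := fun x y a b => by
    change n 0 0 + μS (x ⊗ₜ a) (y ⊗ₜ b) = _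
    rw [map_zero, zero_add, hμS]
  have hμ : ∀ u v, μ u v = - μ v u := by
    intro u v
    induction u using TAG.induction with
    | add x y hx hy => simp only [map_add, LinearMap.add_apply, hx, hy]; ring
    | hB ω =>
      induction v using TAG.induction with
      | add x y hx hy => simp only [map_add, LinearMap.add_apply, hx, hy]; ring
      | hB ω' => rw [hBB, hBB, hn']
      | hS x a => rw [hBS, hSB, neg_zero]
    | hS x a =>
      induction v using TAG.induction with
      | add x y hx hy => simp only [map_add, LinearMap.add_apply, hx, hy]; ring
      | hB ω' => rw [hBS, hSB, neg_zero]
      | hS y b => rw [hSS, hSS, skew, kappa_symm, mul_neg]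
  -- Both sides are alternating in `u, v, w`, so it is enough to treat each type of arguments in one
  -- order.
  have sw₁ : ∀ {u v w}, c u v w = μ ⁅u, v⁆ w - μ ⁅u, w⁆ v + μ ⁅v, w⁆ u →
      c v u w = μ ⁅v, u⁆ w - μ ⁅v, w⁆ u + μ ⁅u, w⁆ v := by
    intro u v w h
    rw [hc.swap₁, h, ← lie_skew u v, map_neg, LinearMap.neg_apply]
    ring
  have sw₂ : ∀ {u v w}, c u v w = μ ⁅u, v⁆ w - μ ⁅u, w⁆ v + μ ⁅v, w⁆ u →
      c u w v = μ ⁅u, w⁆ v - μ ⁅u, v⁆ w + μ ⁅w, v⁆ u := by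
    intro u v w h
    rw [hc.swap₂, h, ← lie_skew v w, map_neg, LinearMap.neg_apply]
    ring
  refine ⟨μ, fun u => eq_zero_of_eq_neg (K := K) (hμ u u), fun u v w => ?_⟩
  have hBBS : ∀ ω ω' x a, c (inB K J ω) (inB K J ω') (inS K J x a) =
      μ ⁅inB K J ω, inB K J ω'⁆ (inS K J x a) - μ ⁅inB K J ω, inS K J x a⁆ (inB K J ω')
        + μ ⁅inB K J ω', inS K J x a⁆ (inB K J ω) := by
    intro ω ω' x a
    simp only [hc.apply_BBS, lie_inB_inB, lie_inB_inS, hBS, hSB]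
    ring
  have hBSS : ∀ ω x y a b, c (inB K J ω) (inS K J x a) (inS K J y b) =
      μ ⁅inB K J ω, inS K J x a⁆ (inS K J y b) - μ ⁅inB K J ω, inS K J y b⁆ (inS K J x a)
        + μ ⁅inS K J x a, inS K J y b⁆ (inB K J ω) := by
    intro ω x y a b
    simp only [hc.apply_BSS, lie_inB_inS, lie_inS_inS, hSS, hSB, hBB, map_add, map_smul,
      LinearMap.add_apply, LinearMap.smul_apply, smul_eq_mul, hn, hg]
    rw [skew (toInner K J ω b), kappa_symm y x]
    ring
  have hSSS : ∀ x y z a b d, c (inS K J x a) (inS K J y b) (inS K J z d) =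
      μ ⁅inS K J x a, inS K J y b⁆ (inS K J z d) - μ ⁅inS K J x a, inS K J z d⁆ (inS K J y b)
        + μ ⁅inS K J y b, inS K J z d⁆ (inS K J x a) := by
    intro x y z a b d
    have h1 : kappa K ⁅x, z⁆ y = - kappa K ⁅x, y⁆ z := by
      rw [← kappa_lie, ← lie_skew, map_neg, kappa_lie]
    have h2 : kappa K ⁅y, z⁆ x = kappa K ⁅x, y⁆ z := by
      rw [kappa_symm, kappa_lie]
    simp only [hc.apply_SSS, lie_inS_inS, hSS, hBS, map_add, map_smul,
      LinearMap.add_apply, LinearMap.smul_apply, smul_eq_mul, hm', h1, h2]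
    rw [mul_comm d a]
    ring
  induction u using TAG.induction with
  | add x y hx hy =>
    simp only [map_add, add_lie, LinearMap.add_apply, hx, hy]
    ring
  | hB ω =>
    induction v using TAG.induction with
    | add x y hx hy =>
      simp only [map_add, add_lie, lie_add, LinearMap.add_apply, hx, hy]
      ring
    | hB ω' =>
      induction w using TAG.induction with
      | add x y hx hy =>
        simp only [map_add, lie_add, LinearMap.add_apply, hx, hy]
        ring
      | hB ω'' => rw [hχ, lie_inB_inB, lie_inB_inB, lie_inB_inB, hBB, hBB, hBB]
      | hS x a => exact hBBS ω ω' x a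
    | hS x a =>
      induction w using TAG.induction with
      | add x y hx hy =>
        simp only [map_add, lie_add, LinearMap.add_apply, hx, hy]
        ring
      | hB ω' => exact sw₂ (hBBS ω ω' x a)
      | hS y b => exact hBSS ω x y a b
  | hS x a =>
    induction v using TAG.induction with
    | add x y hx hy =>
      simp only [map_add, add_lie, lie_add, LinearMap.add_apply, hx, hy]
      ring
    | hB ω =>
      induction w using TAG.induction with
      | add x y hx hy =>
        simp only [map_add, lie_add, LinearMap.add_apply, hx, hy]
        ring
      | hB ω' => exact sw₁ (sw₂ (hBBS ω ω' x a))
      | hS y b => exact sw₁ (hBSS ω x y a b)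
    | hS y b =>
      induction w using TAG.induction with
      | add x y hx hy =>
        simp only [map_add, lie_add, LinearMap.add_apply, hx, hy]
        ring
      | hB ω => exact sw₂ (sw₁ (hBSS ω x y a b))
      | hS z d => exact hSSS x y z a b d

end InvCocycle

end TAG

/-! ### Projection onto the invariants of `sl₂`. -/

section Casimir

variable {K V : Type*} [Field K] [CharZero K] [AddCommGroup V] [Module K V]

/-- For an `sl₂`-triple, acting on a space that is spanned by weight vectors of weights `2j` with
`|j| ≤ 3`, there is a projection onto the invariants given by a polynomial in the triple. -/
theorem exists_invariant_projection (E F H : V →ₗ[K] V)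
    (hHE : ∀ v, H (E v) = E (H v) + (2 : K) • E v) (hHF : ∀ v, H (F v) = F (H v) - (2 : K) • F v)
    (hEF : ∀ v, E (F v) = F (E v) + H v)
    (hspan : Submodule.span K {v | ∃ j : ℤ, |j| ≤ 3 ∧ H v = (2 * j : K) • v} = ⊤) :
    ∃ R : V →ₗ[K] V, (∀ v, R (E v) = 0) ∧ (∀ v, R (F v) = 0) ∧ (∀ v, R (H v) = 0) ∧
      ∀ N : Submodule K V, (∀ v ∈ N, E v ∈ N) → (∀ v ∈ N, F v ∈ N) → (∀ v ∈ N, H v ∈ N) →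
        (∀ v ∈ N, R v ∈ N) ∧ ∀ w, E w ∈ N → F w ∈ N → H w ∈ N → R w - w ∈ N := by
  -- Eigenspaces of `H` are independent, and those of weights up to 6 in absolute value already span
  -- `V`.
  have hb : ∀ (v : V) (j : ℤ), 3 < |j| → H v = (2 * j : K) • v → v = 0 := by
    intro v j hj hv
    have hd := Module.End.eigenspaces_iSupIndep H (2 * j : K)
    refine Submodule.disjoint_def.1 hd v (Module.End.mem_eigenspace_iff.2 hv) ?_
    have hle : Submodule.span K {v | ∃ j : ℤ, |j| ≤ 3 ∧ H v = (2 * j : K) • v} ≤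
        ⨆ (i : K) (_ : i ≠ 2 * j), Module.End.eigenspace H i := by
      refine Submodule.span_le.2 ?_
      rintro u ⟨i, hi, hu⟩
      have hne : (2 * i : K) ≠ 2 * j := by
        intro h
        have : i = j := by exact_mod_cast mul_left_cancel₀ two_ne_zero h
        subst this
        omega
      exact Submodule.mem_iSup_of_mem _ (Submodule.mem_iSup_of_mem hne
        (Module.End.mem_eigenspace_iff.2 hu))
    exact hle (hspan ▸ Submodule.mem_top)
  have hext : ∀ S : V →ₗ[K] V, (∀ (j : ℤ) (v : V), |j| ≤ 3 → H v = (2 * j : K) • v → S v = 0) →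
      ∀ v, S v = 0 := by
    intro S hS v
    have hv : v ∈ Submodule.span K {v | ∃ j : ℤ, |j| ≤ 3 ∧ H v = (2 * j : K) • v} :=
      hspan ▸ Submodule.mem_top
    induction hv using Submodule.span_induction with
    | mem v hv => obtain ⟨j, hj, hv⟩ := hv; exact hS j v hj hv
    | zero => exact map_zero S
    | add x y _ _ hx hy => rw [map_add, hx, hy, add_zero]
    | smul t x _ hx => rw [map_smul, hx, smul_zero]
  let p : K → V →ₗ[K] V := fun t => LinearMap.id - t • (H ∘ₗ H)
  let q : K → V →ₗ[K] V := fun t => LinearMap.id - t • (F ∘ₗ E)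
  have hp : ∀ t v, p t v = v - t • H (H v) := fun _ _ => rfl
  have hq : ∀ t v, q t v = v - t • F (E v) := fun _ _ => rfl
  -- The squares of the nonzero weights `±2, ±4, ±6` are 4, 16 and 36, so `R₀` projects onto weight
  -- zero.
  let R₀ : V →ₗ[K] V := p 4⁻¹ ∘ₗ p 16⁻¹ ∘ₗ p 36⁻¹
  -- On the weight-zero line of the irreducible module of highest weight `2k`, the operator `FE` is
  -- `k(k+1)`. The values 2, 6, 12 for `k = 1, 2, 3` are removed and invariant vectors are kept.
  let r : V →ₗ[K] V := q 2⁻¹ ∘ₗ q 6⁻¹ ∘ₗ q 12⁻¹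
  have hR₀ : ∀ (j : ℤ) (v : V), H v = (2 * j : K) • v →
      R₀ v = ((1 - j ^ 2) * (1 - 4⁻¹ * j ^ 2) * (1 - 9⁻¹ * j ^ 2) : K) • v := by
    intro j v hv
    simp only [R₀, LinearMap.comp_apply, hp, map_sub, map_smul, hv]
    module
  have hR₀' : ∀ (j : ℤ) (v : V), H v = (2 * j : K) • v → j ≠ 0 → R₀ v = 0 := by
    intro j v hv hj
    by_cases h3 : 3 < |j|
    · rw [hb v j h3 hv, map_zero]
    · rw [hR₀ j v hv]
      obtain ⟨h1, h2⟩ := abs_le.1 (not_lt.1 h3)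
      interval_cases j <;> first | exact absurd rfl hj | norm_num
  have hR₀0 : ∀ v, H v = 0 → R₀ v = v := by
    intro v hv
    rw [hR₀ 0 v (by simp [hv])]
    simp
  refine ⟨r ∘ₗ R₀, ?_, ?_, ?_, ?_⟩
  · refine hext (r ∘ₗ R₀ ∘ₗ E) fun j v hj hv => ?_
    have hw : H (E v) = (2 * (j + 1 : ℤ) : K) • E v := by
      rw [hHE, hv, map_smul]; push_cast; module
    simp only [LinearMap.comp_apply]
    by_cases hj1 : j + 1 = 0
    -- The only case in which `E v` has weight zero. The factors `FE - 2`, `FE - 6`, `FE - 12` at `E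
    -- v` become `EF`, `EF - 4`, `EF - 10` at `v`, by `t`. So the claim is that `E` kills `EF(EF -
    -- 4)(EF - 10)v`.
    · obtain rfl : j = -1 := by omega
      replace hv : H v = (-2 : K) • v := by rw [hv]; norm_num
      have w₀ : H (E v) = 0 := by rw [hHE, hv, map_smul]; module
      have w₁ : ∀ {u}, H u = (-2 : K) • u → H (F u) = (-4 : K) • F u := fun {u} hu => by
        rw [hHF, hu, map_smul]; module
      have w₂ : H (F (F v)) = (-6 : K) • F (F v) := by rw [hHF, w₁ hv, map_smul]; module
      -- The weight would be -8, which does not occur.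
      have w₃ : F (F (F v)) = 0 := hb _ (-4) (by norm_num) (by
        rw [hHF, w₂, map_smul]; push_cast; module)
      have w₄ : ∀ {u}, H u = (-2 : K) • u → H (E (F u)) = (-2 : K) • E (F u) := fun {u} hu => by
        rw [hHE, w₁ hu, map_smul]; module
      have s₁ : ∀ {u}, H u = (-2 : K) • u → E (F (F u)) = F (E (F u)) - (4 : K) • F u :=
        fun {u} hu => by rw [hEF (F u), w₁ hu]; module
      have s₂ : F (F (E (F v))) = (10 : K) • F (F v) := by
        have h := hEF (F (F v))
        rw [w₃, map_zero, s₁ hv, map_sub, map_smul, w₂] at h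
        linear_combination (norm := module) -h
      -- This says `F(EF - 4)(EF - 10)v = 0`. Applying `E` twice gives the claim.
      have s₃ : F (E (F (E (F v)))) = (14 : K) • F (E (F v)) - (40 : K) • F v := by
        have h := congrArg E s₂
        rw [s₁ (w₄ hv), map_smul, s₁ hv] at h
        linear_combination (norm := module) h
      have s₄ := congrArg (fun u => E (E u)) s₃
      simp only [map_sub, map_smul] at s₄
      have t : ∀ {u}, H u = (-2 : K) • u → F (E (E u)) = E (E (F u)) + (2 : K) • E u :=
        fun {u} hu => by
          have h := hEF (E u)
          have hu' : H (E u) = 0 := by rw [hHE, hu, map_smul]; module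
          rw [hu', add_zero] at h
          have h' := hEF u
          rw [hu] at h'
          have h'' := congrArg E h'
          rw [map_add, map_smul] at h''
          rw [← h]
          linear_combination (norm := module) -h''
      rw [hR₀0 _ w₀]
      simp only [r, LinearMap.comp_apply, hq, map_sub, map_add, map_smul, t hv, t (w₄ hv),
        t (w₄ (w₄ hv)), s₄]
      module
    · rw [hR₀' _ _ hw hj1, map_zero]
  · refine hext (r ∘ₗ R₀ ∘ₗ F) fun j v hj hv => ?_
    have hw : H (F v) = (2 * (j - 1 : ℤ) : K) • F v := by
      rw [hHF, hv, map_smul]; push_cast; module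
    simp only [LinearMap.comp_apply]
    by_cases hj1 : j - 1 = 0
    -- The mirror image of the previous case, with `E` and `F` exchanged: now `FE(FE - 4)(FE - 10)v`
    -- is killed by `F`.
    · obtain rfl : j = 1 := by omega
      replace hv : H v = (2 : K) • v := by rw [hv]; norm_num
      have w₀ : H (F v) = 0 := by rw [hHF, hv, map_smul]; module
      have w₁ : ∀ {u}, H u = (2 : K) • u → H (E u) = (4 : K) • E u := fun {u} hu => by
        rw [hHE, hu, map_smul]; module
      have w₂ : H (E (E v)) = (6 : K) • E (E v) := by rw [hHE, w₁ hv, map_smul]; module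
      have w₃ : E (E (E v)) = 0 := hb _ 4 (by norm_num) (by
        rw [hHE, w₂, map_smul]; push_cast; module)
      have w₄ : ∀ {u}, H u = (2 : K) • u → H (F (E u)) = (2 : K) • F (E u) := fun {u} hu => by
        rw [hHF, w₁ hu, map_smul]; module
      have s₁ : ∀ {u}, H u = (2 : K) • u → F (E (E u)) = E (F (E u)) - (4 : K) • E u :=
        fun {u} hu => by rw [hEF (E u), w₁ hu]; module
      have s₂ : E (E (F (E v))) = (10 : K) • E (E v) := by
        have h := hEF (E (E v))
        rw [w₃, map_zero, s₁ hv, map_sub, map_smul, w₂] at h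
        linear_combination (norm := module) h
      have s₃ : E (F (E (F (E v)))) = (14 : K) • E (F (E v)) - (40 : K) • E v := by
        have h := congrArg F s₂
        rw [s₁ (w₄ hv), map_smul, s₁ hv] at h
        linear_combination (norm := module) h
      have s₄ := congrArg (fun u => F (F u)) s₃
      simp only [map_sub, map_smul] at s₄
      have t : ∀ {u}, H u = (2 : K) • u → F (E (F u)) = F (F (E u)) + (2 : K) • F u :=
        fun {u} hu => by rw [hEF u, hu, map_add, map_smul]
      rw [hR₀0 _ w₀]
      simp only [r, LinearMap.comp_apply, hq, map_sub, map_add, map_smul, t hv, t (w₄ hv),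
        t (w₄ (w₄ hv)), s₄]
      module
    · rw [hR₀' _ _ hw hj1, map_zero]
  · refine hext (r ∘ₗ R₀ ∘ₗ H) fun j v hj hv => ?_
    simp only [LinearMap.comp_apply, hv, map_smul]
    by_cases hj0 : j = 0
    · simp [hj0]
    · rw [hR₀' j v hv hj0, map_zero, smul_zero]
  · intro N hE hF hH
    -- The operators that preserve `N` and act as the identity, modulo `N`, on vectors invariant
    -- modulo `N`. They are closed under composition, and every factor of `R` is one of them.
    let P : (V →ₗ[K] V) → Prop := fun S => (∀ v ∈ N, S v ∈ N) ∧
      ∀ w, E w ∈ N → F w ∈ N → H w ∈ N → S w - w ∈ N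
    have comp : ∀ S T, P S → P T → P (S ∘ₗ T) := by
      intro S T hS hT
      refine ⟨fun v hv => hS.1 _ (hT.1 v hv), fun w h1 h2 h3 => ?_⟩
      have e : (S ∘ₗ T) w - w = S (T w - w) + (S w - w) := by
        rw [map_sub, LinearMap.comp_apply]; abel
      rw [e]
      exact add_mem (hS.1 _ (hT.2 w h1 h2 h3)) (hS.2 w h1 h2 h3)
    have hPp : ∀ t, P (p t) := fun t =>
      ⟨fun v hv => sub_mem hv (N.smul_mem t (hH _ (hH _ hv))), fun w h1 h2 h3 => by
        rw [hp, sub_sub_cancel_left]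
        exact neg_mem (N.smul_mem t (hH _ h3))⟩
    have hPq : ∀ t, P (q t) := fun t =>
      ⟨fun v hv => sub_mem hv (N.smul_mem t (hF _ (hE _ hv))), fun w h1 h2 h3 => by
        rw [hq, sub_sub_cancel_left]
        exact neg_mem (N.smul_mem t (hF _ h1))⟩
    exact comp _ _ (comp _ _ (hPq _) (comp _ _ (hPq _) (hPq _)))
      (comp _ _ (hPp _) (comp _ _ (hPp _) (hPp _)))

end Casimir

/-! ### Weights and linear forms on the exterior algebra. -/

namespace LieHomology

open ExteriorAlgebra

variable {K L : Type*} [Field K] [AddCommGroup L] [Module K L]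

/-- If `L` is spanned by weight vectors of weights `0, ±2` for `φ`, then `Λᵏ L` is spanned by
weight vectors of weights `2j`, `|j| ≤ k`. -/
theorem mem_span_weight (φ : L →ₗ[K] L)
    (hφ : ∀ u, u ∈ Submodule.span K {u | ∃ j : ℤ, |j| ≤ 1 ∧ φ u = (2 * j : K) • u})
    (k : ℕ) {w : ExteriorAlgebra K L} (hw : w ∈ ⋀[K]^k L) :
    w ∈ Submodule.span K {w | w ∈ ⋀[K]^k L ∧ ∃ j : ℤ, |j| ≤ k ∧ extDer φ w = (2 * j : K) • w} := by
  induction k generalizing w with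
  | zero =>
    refine Submodule.subset_span ⟨hw, 0, by simp, ?_⟩
    rw [exteriorPower, pow_zero] at hw
    obtain ⟨r, rfl⟩ := Submodule.mem_one.1 hw
    rw [Algebra.algebraMap_eq_smul_one, map_smul, extDer_one, smul_zero]
    simp
  | succ k ih =>
    rw [exteriorPower, pow_succ'] at hw
    induction hw using Submodule.mul_induction_on' with
    | add x _ y _ hx hy => exact add_mem hx hy
    | mem_mul_mem m hm n hn =>
      obtain ⟨y, rfl⟩ := hm
      have hn' := ih hn
      clear hn
      induction hφ y, hn' using Submodule.span_induction₂ with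
      | mem_mem y n hy hn =>
        obtain ⟨i, hi, hy⟩ := hy
        obtain ⟨hn, j, hj, hn'⟩ := hn
        refine Submodule.subset_span ⟨?_, i + j, ?_, ?_⟩
        · rw [exteriorPower, pow_succ']
          exact Submodule.mul_mem_mul ⟨_, rfl⟩ hn
        · push_cast
          exact (abs_add_le i j).trans (by omega)
        · rw [extDer_ι_mul, hy, hn', map_smul, smul_mul_assoc, mul_smul_comm, ← add_smul]
          push_cast
          rw [mul_add]
      | zero_left b hb => rw [map_zero, zero_mul]; exact zero_mem _
      | zero_right b hb => rw [mul_zero]; exact zero_mem _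
      | add_left x y z _ _ _ hx hy => rw [map_add, add_mul]; exact add_mem hx hy
      | add_right x y z _ _ _ hx hy => rw [mul_add]; exact add_mem hx hy
      | smul_left t x y _ _ h => rw [map_smul, smul_mul_assoc]; exact Submodule.smul_mem _ t h
      | smul_right t x y _ _ h => rw [mul_smul_comm]; exact Submodule.smul_mem _ t h

/-- Linear forms on `Λ L` agree on `Λ³ L` if they do so on products of three elements. -/
theorem eqOn_three {f g : ExteriorAlgebra K L →ₗ[K] K}
    (h : ∀ x y z, f (ι K x * (ι K y * ι K z)) = g (ι K x * (ι K y * ι K z)))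
    {w : ExteriorAlgebra K L} (hw : w ∈ ⋀[K]^3 L) : f w = g w := by
  rw [exteriorPower, pow_succ', pow_two] at hw
  induction hw using Submodule.mul_induction_on' with
  | add x _ y _ hx hy => rw [map_add, map_add, hx, hy]
  | mem_mul_mem m hm n hn =>
    induction hn using Submodule.mul_induction_on' with
    | add x _ y _ hx hy => rw [mul_add, map_add, map_add, hx, hy]
    | mem_mul_mem n hn n' hn' =>
      obtain ⟨x, rfl⟩ := hm
      obtain ⟨y, rfl⟩ := hn
      obtain ⟨z, rfl⟩ := hn'
      exact h x y z

theorem three_mem (x y z : L) : ι K x * (ι K y * ι K z) ∈ ⋀[K]^3 L := by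
  rw [exteriorPower, pow_succ', pow_two]
  exact Submodule.mul_mem_mul ⟨_, rfl⟩ (Submodule.mul_mem_mul ⟨_, rfl⟩ ⟨_, rfl⟩)

/-- An alternating bilinear form on `L` extends to a linear form on `Λ L`. -/
theorem exists_form (μ : L →ₗ[K] L →ₗ[K] K) (hμ : ∀ u, μ u u = 0) :
    ∃ f : ExteriorAlgebra K L →ₗ[K] K, ∀ x y, f (ι K x * ι K y) = μ x y := by
  let A : L [⋀^Fin 2]→ₗ[K] K :=
    { toFun := fun v => μ (v 0) (v 1)
      map_update_add' := by
        intro _ v i x y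
        fin_cases i <;> simp [Function.update]
      map_update_smul' := by
        intro _ v i t x
        fin_cases i <;> simp [Function.update]
      map_eq_zero_of_eq' := by
        intro v i j hv hij
        have : v 0 = v 1 := by
          fin_cases i <;> fin_cases j <;> simp_all
        rw [this, hμ] }
  -- `liftAlternating` takes an alternating map in every degree: `A` in degree 2, and zero in the
  -- others.
  refine ⟨liftAlternating (Pi.single 2 A), fun x y => ?_⟩
  have h := liftAlternating_apply_ιMulti (R := K) (M := L) (N := K) (Pi.single 2 A) ![x, y]
  rw [Pi.single_eq_same] at h
  rw [ιMulti_apply] at h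
  simpa [A] using h

end LieHomology

/-! ### From an invariant homology class to an invariant cocycle. -/

namespace TAG

section
variable {K J : Type*} [Field K] [CharZero K] [NonUnitalNonAssocCommRing J] [Module K J]
  [IsScalarTower K J J] [SMulCommClass K J J] [IsCommJordan J]

theorem mem_span_weight (u : TAG K J) : u ∈ Submodule.span K {u : TAG K J | ∃ j : ℤ, |j| ≤ 1 ∧
    (sl2Action K J (sl2H K) : TAG K J →ₗ[K] TAG K J) u = (2 * j : K) • u} := by
  induction u using TAG.induction with
  | add x y hx hy => exact add_mem hx hy
  | hB ω =>
    refine Submodule.subset_span ⟨0, by simp, ?_⟩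
    rw [LieDerivation.coeFn_coe, sl2Action_inB]
    simp
  | hS x a =>
    rw [sl2_decomp x]
    simp only [map_add, map_smul, LinearMap.add_apply, LinearMap.smul_apply]
    refine add_mem (add_mem ?_ ?_) ?_ <;> refine Submodule.smul_mem _ _ (Submodule.subset_span ?_)
    · refine ⟨1, by simp, ?_⟩
      rw [LieDerivation.coeFn_coe, sl2Action_inS, lie_H_E]
      simp
    · refine ⟨-1, by simp, ?_⟩
      rw [LieDerivation.coeFn_coe, sl2Action_inS, lie_H_F]
      simp
    · refine ⟨0, by simp, ?_⟩
      rw [LieDerivation.coeFn_coe, sl2Action_inS, lie_self]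
      simp

variable (K J) in
/-- The action of an element of `sl₂` on `Λ TAG(J)`. -/
def extAction : sl2 K →ₗ[K] ExteriorAlgebra K (TAG K J) →ₗ[K] ExteriorAlgebra K (TAG K J) where
  toFun s := LieHomology.extDer (sl2Action K J s : TAG K J →ₗ[K] TAG K J)
  map_add' s t := by
    rw [← LieHomology.extDer_add, map_add]
    rfl
  map_smul' t s := by
    rw [RingHom.id_apply, ← LieHomology.extDer_smul, map_smul]
    rfl

theorem extAction_lie (s t : sl2 K) (w : ExteriorAlgebra K (TAG K J)) :
    extAction K J ⁅s, t⁆ w =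
      extAction K J s (extAction K J t w) - extAction K J t (extAction K J s w) := by
  have h := LinearMap.congr_fun (LieHomology.extDer_comm
    (sl2Action K J s : TAG K J →ₗ[K] TAG K J) (sl2Action K J t : TAG K J →ₗ[K] TAG K J)) w
  refine Eq.trans ?_ h
  change LieHomology.extDer _ w = _
  rw [LieHom.map_lie]
  rfl

theorem extAction_mem (s : sl2 K) (k : ℕ) {w : ExteriorAlgebra K (TAG K J)}
    (hw : w ∈ ⋀[K]^k (TAG K J)) : extAction K J s w ∈ ⋀[K]^k (TAG K J) :=
  LieHomology.extDer_mem _ k hw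

/-- Derivations of the Lie algebra commute with the differential. -/
theorem extAction_mem_boundaries (s : sl2 K) (k : ℕ) {w : ExteriorAlgebra K (TAG K J)}
    (hw : w ∈ LieHomology.boundaries K (TAG K J) k) :
    extAction K J s w ∈ LieHomology.boundaries K (TAG K J) k := by
  obtain ⟨v, hv, rfl⟩ := hw
  refine ⟨extAction K J s v, extAction_mem s _ hv, ?_⟩
  exact LinearMap.congr_fun (LieHomology.ceD_comp_extDer (sl2Action K J s)) v

/-- An invariant class in `H₃(TAG(J))` that does not vanish is detected by an invariant linear
form on `Λ³ TAG(J)` that vanishes on boundaries. -/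
theorem exists_invariant_form {w : ExteriorAlgebra K (TAG K J)} (hw : w ∈ ⋀[K]^3 (TAG K J))
    (hinv : ∀ s, extAction K J s w ∈ LieHomology.boundaries K (TAG K J) 3)
    (hne : w ∉ LieHomology.boundaries K (TAG K J) 3) :
    ∃ f : ExteriorAlgebra K (TAG K J) →ₗ[K] K, f w ≠ 0 ∧
      (∀ v ∈ LieHomology.boundaries K (TAG K J) 3, f v = 0) ∧
      ∀ s, ∀ v ∈ ⋀[K]^3 (TAG K J), f (extAction K J s v) = 0 := by
  let V := ⋀[K]^3 (TAG K J)
  let ρ : sl2 K → V →ₗ[K] V := fun s => (extAction K J s).restrict fun v hv => extAction_mem s 3 hv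
  have hρ : ∀ s (v : V), (ρ s v : ExteriorAlgebra K (TAG K J)) = extAction K J s v :=
    fun _ _ => rfl
  have hlie : ∀ s t (v : V), ρ s (ρ t v) = ρ t (ρ s v) + ρ ⁅s, t⁆ v := by
    intro s t v
    apply Subtype.ext
    rw [Submodule.coe_add, hρ, hρ, hρ, hρ, hρ, extAction_lie]
    abel
  have hsmul : ∀ (t : K) s (v : V), ρ (t • s) v = t • ρ s v := by
    intro t s v
    apply Subtype.ext
    rw [Submodule.coe_smul, hρ, hρ, map_smul]
    rfl
  have hspan : Submodule.span K {v : V | ∃ j : ℤ, |j| ≤ 3 ∧ ρ (sl2H K) v = (2 * j : K) • v}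
      = ⊤ := by
    refine Submodule.eq_top_iff'.2 fun v => ?_
    have hv := LieHomology.mem_span_weight _ mem_span_weight 3 v.2
    have key : ∀ (x : ExteriorAlgebra K (TAG K J)), x ∈ Submodule.span K
        {w | w ∈ ⋀[K]^3 (TAG K J) ∧ ∃ j : ℤ, |j| ≤ ((3 : ℕ) : ℤ) ∧ LieHomology.extDer
          (sl2Action K J (sl2H K) : TAG K J →ₗ[K] TAG K J) w = (2 * j : K) • w} →
        x ∈ (Submodule.span K {v : V | ∃ j : ℤ, |j| ≤ 3 ∧
          ρ (sl2H K) v = (2 * j : K) • v}).map V.subtype := by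
      intro x hx
      refine Submodule.span_le.2 ?_ hx
      rintro u ⟨hu, j, hj, hju⟩
      exact ⟨⟨u, hu⟩, Submodule.subset_span ⟨j, hj, Subtype.ext hju⟩, rfl⟩
    obtain ⟨u, hu, huv⟩ := key v hv
    rwa [← Subtype.ext huv]
  obtain ⟨R, hRE, hRF, hRH, hRN⟩ := exists_invariant_projection (ρ (sl2E K)) (ρ (sl2F K))
    (ρ (sl2H K)) (fun v => by rw [hlie, lie_H_E, hsmul])
    (fun v => by rw [hlie, lie_H_F, hsmul]; module)
    (fun v => by rw [hlie, lie_E_F]) hspan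
  let N : Submodule K V := (LieHomology.boundaries K (TAG K J) 3).comap V.subtype
  have hN : ∀ s, ∀ v ∈ N, ρ s v ∈ N := fun s v hv => extAction_mem_boundaries s 3 hv
  obtain ⟨h1, h2⟩ := hRN N (hN _) (hN _) (hN _)
  -- The form `g` separates `w` from the boundaries but need not be invariant. Its composite with
  -- `R` is invariant, still vanishes on boundaries, and has the same value at `w` because `R w - w`
  -- is a boundary.
  obtain ⟨g, hgw, hg⟩ := Submodule.exists_le_ker_of_notMem hne
  have hRw := h2 ⟨w, hw⟩ (hinv _) (hinv _) (hinv _)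
  obtain ⟨f, hf⟩ := LinearMap.exists_extend (g ∘ₗ V.subtype ∘ₗ R)
  have hf' : ∀ v : V, f v = g (R v) := fun v => LinearMap.congr_fun hf v
  refine ⟨f, ?_, fun v hv => ?_, fun s v hv => ?_⟩
  · have h := hf' ⟨w, hw⟩
    have h3 := hg hRw
    rw [LinearMap.mem_ker, map_sub, map_sub, sub_eq_zero] at h3
    change f w = g (R ⟨w, hw⟩) at h
    rw [h]
    change g (R ⟨w, hw⟩) = g w at h3
    rwa [h3]
  · have hv3 : v ∈ V := (LieHomology.boundaries_le_cycles K (TAG K J) 3 hv).1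
    exact (hf' ⟨v, hv3⟩).trans (hg (h1 ⟨v, hv3⟩ hv))
  · have h : ∀ s, f (extAction K J s v) = g (R (ρ s ⟨v, hv⟩)) := fun s => hf' (ρ s ⟨v, hv⟩)
    rw [sl2_decomp s]
    simp only [map_add, map_smul, LinearMap.add_apply, LinearMap.smul_apply, h, hRE, hRF, hRH]
    simp

end

/-- A `3`-cycle of `TAG(J)`, for a free Jordan algebra `J`, is a boundary if its class is
invariant. -/
theorem mem_boundaries_of_invariant {K X : Type*} [Field K] [CharZero K]
    {w : ExteriorAlgebra K (TAG K (FreeJordan K X))}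
    (hw : w ∈ LieHomology.cycles K (TAG K (FreeJordan K X)) 3)
    (hinv : ∀ s, extAction K (FreeJordan K X) s w ∈
      LieHomology.boundaries K (TAG K (FreeJordan K X)) 3) :
    w ∈ LieHomology.boundaries K (TAG K (FreeJordan K X)) 3 := by
  by_contra hne
  obtain ⟨f, hfw, hfb, hfs⟩ := exists_invariant_form hw.1 hinv hne
  set L := TAG K (FreeJordan K X)
  let c : L →ₗ[K] L →ₗ[K] L →ₗ[K] K := LinearMap.mk₂ K
    (fun x y => f ∘ₗ LinearMap.mulLeft K (ExteriorAlgebra.ι K x) ∘ₗ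
      LinearMap.mulLeft K (ExteriorAlgebra.ι K y) ∘ₗ ExteriorAlgebra.ι K)
    (fun _ _ _ => LinearMap.ext fun _ => by simp [add_mul])
    (fun _ _ _ => LinearMap.ext fun _ => by simp)
    (fun _ _ _ => LinearMap.ext fun _ => by simp [add_mul, mul_add])
    (fun _ _ _ => LinearMap.ext fun _ => by simp)
  have hcf : ∀ x y z, c x y z =
      f (ExteriorAlgebra.ι K x * (ExteriorAlgebra.ι K y * ExteriorAlgebra.ι K z)) :=
    fun _ _ _ => rfl
  have anti : ∀ a b : L, ExteriorAlgebra.ι K a * ExteriorAlgebra.ι K b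
      = - (ExteriorAlgebra.ι K b * ExteriorAlgebra.ι K a) := fun a b =>
    eq_neg_of_add_eq_zero_left (ExteriorAlgebra.ι_add_mul_swap a b)
  have hc : InvCocycle K (FreeJordan K X) c :=
    { swap₁ := fun u v w => by
        rw [hcf, hcf, ← mul_assoc, anti u v, neg_mul, map_neg, mul_assoc]
      swap₂ := fun u v w => by
        rw [hcf, hcf, anti v w, mul_neg, map_neg]
      inv := fun s u v w => by
        have h := hfs s _ (LieHomology.three_mem u v w)
        change f (LieHomology.extDer _ _) = 0 at h
        rw [LieHomology.extDer_ι_mul, LieHomology.extDer_ι_mul, LieHomology.extDer_ι, mul_add,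
          map_add, map_add] at h
        rw [hcf, hcf, hcf, add_assoc]
        exact h
      -- The cocycle condition is the vanishing of `f` on the boundary of `x ∧ y ∧ z ∧ t`.
      cocycle := fun x y z t => by
        have h := hfb _ ⟨ExteriorAlgebra.ι K x * (ExteriorAlgebra.ι K y *
          (ExteriorAlgebra.ι K z * ExteriorAlgebra.ι K t)), by
            rw [SetLike.mem_coe, ExteriorAlgebra.exteriorPower, pow_succ']
            exact Submodule.mul_mem_mul ⟨_, rfl⟩ (LieHomology.three_mem y z t), rfl⟩
        rw [LieHomology.ceD_ι_mul, LieHomology.ceD_three] at h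
        simp only [LieHomology.extDer_ι_mul, LieHomology.extDer_ι, LieModule.toEnd_apply_apply,
          mul_add, mul_sub, map_add, map_sub] at h
        simp only [hcf]
        linear_combination h }
  obtain ⟨m, hm, hm'⟩ := FreeJordan.exists_alternating (cochainS c) (cochainB c)
    hc.cochainS_swap₁ hc.cochainS_swap₂ hc.cochainB_skew hc.cocycle_SSSS hc.cocycle_BSSS
  obtain ⟨μ, hμ, hcμ⟩ := hc.exists_primitive m hm hm'
  obtain ⟨g, hg⟩ := LieHomology.exists_form μ hμ
  -- On `Λ³` the form `f` is `g` composed with the differential, hence zero at the cycle `w`.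
  have h : f w = (g ∘ₗ LieHomology.ceD K L) w := by
    refine LieHomology.eqOn_three (fun x y z => ?_) hw.1
    rw [LinearMap.comp_apply, LieHomology.ceD_three, map_add, map_sub, hg, hg, hg, ← hcμ, hcf]
  rw [LinearMap.comp_apply, LinearMap.mem_ker.1 hw.2, map_zero] at h
  exact hfw h

end TAG

end

theorem mainTheorem5 (K : Type*) [Field K] [CharZero K] (D : ℕ) :
    LieHomology.invariants (TAG.sl2Action K (FreeJordan K (Fin D))) 3 = ⊥ := by
  refine (Submodule.eq_bot_iff _).2 fun x hx => ?_
  obtain ⟨⟨w, hw⟩, rfl⟩ := Submodule.Quotient.mk_surjective _ x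
  refine (Submodule.Quotient.mk_eq_zero _).2 (TAG.mem_boundaries_of_invariant hw fun s => ?_)
  -- Invariance of the class of `w` means that each `s ∈ sl₂` sends `w` to a boundary.
  have h := LinearMap.mem_ker.1 ((Submodule.mem_iInf _).1 hx s)
  exact (Submodule.Quotient.mk_eq_zero ((LieHomology.boundaries K
    (TAG K (FreeJordan K (Fin D))) 3).submoduleOf (LieHomology.cycles K _ 3))).1 h
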